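/- Let $d\ge 1$, $\mu\in\mathbb R^d$, and let $\Sigma\in\mathbb R^{d\times d}$ be symmetric positive definite, $\mathbb P=N(\mu,\Sigma)$. For probability measures $P,Q$ on $\mathbb R^d$ let $$\mathcal W_2(P,Q)=\inf_{\pi}\Big(\int\|x-y\|^2\,\pi(dx,dy)\Big)^{1/2},$$ the infimum being over all couplings $\pi$ of $P$ and $Q$. Let $S(\mathbb R^d)$ be the space of symmetric $d\times d$ matrices, $S_+(\mathbb R^d)$ its open subset of positive definite matrices, and $$\Phi(\mu,\nu,A,B)=\|\mu-\nu\|^2+\operatorname{tr}A+\operatorname{tr}B-2\operatorname{tr}\big((A^{1/2}BA^{1/2})^{1/2}\big),\qquad \mu,\nu\in\mathbb R^d,\ A,B\in S_+(\mathbb R^d).$$ Let $X_1,X_2,\dots$ be i.i.d. with law $\mathbb P$, and put $\hat\mu_n=\frac1n\sum_{i\le n}X_i$, $\hat\Sigma_n=\frac1{n-1}\sum_{i\le n}(X_i-\hat\mu_n)(X_i-\hat\mu_n)^t$. Let $Y_1,Y_2,\dots$ be a second i.i.d. sample with law $\mathbb P$, independent of the first, with sample mean $\hat\nu_n$ and sample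 covariance matrix $\hat\Xi_n$ defined in the same way. Put $$\widehat{\mathcal{GW}}_n=\mathcal W_2^2\big(N(\hat\mu_n,\hat\Sigma_n),\mathbb P\big),\qquad \widehat{\mathcal{GW}}_{n,n}=\mathcal W_2^2\big(N(\hat\mu_n,\hat\Sigma_n),N(\hat\nu_n,\hat\Xi_n)\big).$$ Then $\Phi$ is Fréchet differentiable near $\theta=(\mu,\mu,\Sigma,\Sigma)$ (as a function on an open subset of $\mathbb R^{d}\times\mathbb R^d\times S(\mathbb R^d)\times S(\mathbb R^d)$) and twice Fréchet differentiable at $\theta$, with $D_\theta\Phi=0$, and, as $n\to\infty$, $$n\,\widehat{\mathcal{GW}}_n\Rightarrow Z_1=\tfrac12 D^2_\theta\Phi\big[(g,0,G,0),(g,0,G,0)\big],\qquad n\,\widehat{\mathcal{GW}}_{n,n}\Rightarrow Z_2=\tfrac12 D^2_\theta\Phi\big[(g,g',G,G'),(g,g',G,G')\big].$$ Here $g,g'\sim N(0,\Sigma)$, $G=\Sigma^{1/2}H\Sigma^{1/2}$, $G'=\Sigma^{1/2}H'\Sigma^{1/2}$; $H,H'$ are symmetric random $d\times d$ matrices whose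 entries on and above the diagonal are independent, with law $N(0,2)$ on the diagonal and $N(0,1)$ off the diagonal; and $g,g',H,H'$ are independent. Neither $Z_1$ nor $Z_2$ is almost surely constant. -/

import Mathlib

open MeasureTheory ProbabilityTheory Filter Topology
open scoped MatrixOrder Matrix.Norms.L2Operator ENNReal

noncomputable section

namespace GaussianWasserstein

/-! ### Wasserstein distance -/

/-- `ℝᵈ` with its Euclidean norm. -/
abbrev Vec (d : ℕ) : Type := EuclideanSpace ℝ (Fin d)

/-- The couplings of `P` and `Q`: the probability measures on the product space with first
marginal `P` and second marginal `Q`. -/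
def couplings {d : ℕ} (P Q : Measure (Vec d)) : Set (Measure (Vec d × Vec d)) :=
  {π | IsProbabilityMeasure π ∧ π.map Prod.fst = P ∧ π.map Prod.snd = Q}

/-- The `p`-Wasserstein distance, with values in `[0, ∞]`. -/
def wasserstein {d : ℕ} (p : ℝ) (P Q : Measure (Vec d)) : ℝ≥0∞ :=
  ⨅ π ∈ couplings P Q, (∫⁻ z, ‖z.1 - z.2‖ₑ ^ p ∂π) ^ (1 / p)

/-- The squared 2-Wasserstein distance as a real number. -/
def wassersteinTwoSq {d : ℕ} (P Q : Measure (Vec d)) : ℝ :=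
  (wasserstein 2 P Q).toReal ^ 2

/-! ### Samples and estimators -/

/-- `X 0, X 1, …` are i.i.d. with common law `Q`. -/
def IsIIDSample {Ω : Type*} [MeasurableSpace Ω] {d : ℕ} (X : ℕ → Ω → Vec d)
    (Q : Measure (Vec d)) (P : Measure Ω) : Prop :=
  iIndepFun X P ∧ ∀ i, HasLaw (X i) Q P

/-- The mean of the first `n` observations `x 0, …, x (n - 1)`. -/
def sampleMean {d : ℕ} (n : ℕ) (x : ℕ → Vec d) : Vec d :=
  (n : ℝ)⁻¹ • ∑ i ∈ Finset.range n, x i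

/-- The sample covariance matrix of the first `n` observations,
`(n - 1)⁻¹ ∑ (xᵢ - x̄)(xᵢ - x̄)ᵗ`. -/
def sampleCov {d : ℕ} (n : ℕ) (x : ℕ → Vec d) : Matrix (Fin d) (Fin d) ℝ :=
  ((n : ℝ) - 1)⁻¹ • ∑ i ∈ Finset.range n,
    Matrix.vecMulVec (x i - sampleMean n x).ofLp (x i - sampleMean n x).ofLp

/-- The Gaussian measure fitted to the first `n` observations. -/
def fittedGaussian {d : ℕ} (n : ℕ) (x : ℕ → Vec d) : Measure (Vec d) :=
  multivariateGaussian (sampleMean n x) (sampleCov n x)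

/-- One sample Gaussian Wasserstein estimator. -/
def gwOne {d : ℕ} (n : ℕ) (x : ℕ → Vec d) (Q : Measure (Vec d)) : ℝ :=
  wassersteinTwoSq (fittedGaussian n x) Q

/-- Two sample Gaussian Wasserstein estimator (sample sizes `n` and `m`). -/
def gwTwo {d : ℕ} (n m : ℕ) (x y : ℕ → Vec d) : ℝ :=
  wassersteinTwoSq (fittedGaussian n x) (fittedGaussian m y)

/-! ### The Gaussian Wasserstein functional -/

/-- The real vector space of symmetric `d × d` matrices, with the operator norm. -/
abbrev SymMat (d : ℕ) : Type := selfAdjoint.submodule ℝ (Matrix (Fin d) (Fin d) ℝ)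

instance (d : ℕ) : MeasurableSpace (SymMat d) := borel _

instance (d : ℕ) : BorelSpace (SymMat d) := ⟨rfl⟩

/-- A positive definite matrix as an element of the space of symmetric matrices. -/
def toSym {d : ℕ} (S : Matrix (Fin d) (Fin d) ℝ) (hS : S.PosDef) : SymMat d :=
  ⟨S, hS.isHermitian⟩

/-- The functional
`(μ, ν, A, B) ↦ ‖μ - ν‖² + tr A + tr B - 2 tr ((A^{1/2} B A^{1/2})^{1/2})`.
It is meaningful on the set where `A` and `B` are positive definite, which is open in the space
of quadruples. -/
def Φ (d : ℕ) (θ : Vec d × Vec d × SymMat d × SymMat d) : ℝ :=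
  ‖θ.1 - θ.2.1‖ ^ 2 + (θ.2.2.1 : Matrix (Fin d) (Fin d) ℝ).trace
    + (θ.2.2.2 : Matrix (Fin d) (Fin d) ℝ).trace
    - 2 * (CFC.sqrt (CFC.sqrt (θ.2.2.1 : Matrix (Fin d) (Fin d) ℝ)
        * (θ.2.2.2 : Matrix (Fin d) (Fin d) ℝ)
        * CFC.sqrt (θ.2.2.1 : Matrix (Fin d) (Fin d) ℝ))).trace

/-- The quadratic form `h ↦ D²_θ Φ[h, h]` of the second Fréchet derivative of `Φ` at `θ`. -/
def secondDerivΦ (d : ℕ) (θ h : Vec d × Vec d × SymMat d × SymMat d) : ℝ :=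
  fderiv ℝ (fderiv ℝ (Φ d)) θ h h

/-! ### The Gaussian limit of the sample mean and covariance -/

/-- Positions in the upper triangle (with diagonal) of a `d × d` matrix. -/
abbrev UpperIdx (d : ℕ) : Type := {p : Fin d × Fin d // p.1 ≤ p.2}

/-- The symmetric matrix with given upper triangle. -/
def symOfUpper {d : ℕ} (x : UpperIdx d → ℝ) : SymMat d :=
  ⟨Matrix.of fun i j => x ⟨(min i j, max i j), min_le_max⟩, by
    refine Matrix.ext fun i j => ?_
    simp [min_comm, max_comm]⟩

/-- The law of a symmetric random matrix `H` whose upper triangular entries are independent,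
`N(0, 2)` on the diagonal and `N(0, 1)` off the diagonal. -/
def wignerLaw (d : ℕ) : Measure (SymMat d) :=
  (Measure.pi fun p : UpperIdx d => gaussianReal 0 (if p.1.1 = p.1.2 then 2 else 1)).map symOfUpper

/-- `H ↦ S^{1/2} H S^{1/2}` on symmetric matrices. -/
def conjSqrt {d : ℕ} (S : Matrix (Fin d) (Fin d) ℝ) (H : SymMat d) : SymMat d :=
  ⟨CFC.sqrt S * (H : Matrix (Fin d) (Fin d) ℝ) * CFC.sqrt S, by
    have h : IsSelfAdjoint (CFC.sqrt S) := (CFC.sqrt_nonneg S).isSelfAdjoint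
    have hH : IsSelfAdjoint (H : Matrix (Fin d) (Fin d) ℝ) := H.2
    show IsSelfAdjoint _
    rw [IsSelfAdjoint, star_mul, star_mul, h.star_eq, hH.star_eq, mul_assoc]⟩

/-- The law of `(g, G)` with `g ∼ N(0, S)` and `G = S^{1/2} H S^{1/2}` independent. -/
def meanCovLimit {d : ℕ} (S : Matrix (Fin d) (Fin d) ℝ) : Measure (Vec d × SymMat d) :=
  (multivariateGaussian 0 S).prod ((wignerLaw d).map (conjSqrt S))

theorem continuous_symOfUpper {d : ℕ} : Continuous (symOfUpper (d := d)) := by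
  refine Continuous.subtype_mk ?_ _
  exact continuous_matrix fun i j => continuous_apply _

theorem continuous_conjSqrt {d : ℕ} (S : Matrix (Fin d) (Fin d) ℝ) :
    Continuous (conjSqrt S) := by
  refine Continuous.subtype_mk ?_ _
  exact (continuous_const.mul continuous_subtype_val).mul continuous_const

instance (d : ℕ) : IsProbabilityMeasure (wignerLaw d) :=
  Measure.isProbabilityMeasure_map continuous_symOfUpper.measurable.aemeasurable

instance {d : ℕ} (S : Matrix (Fin d) (Fin d) ℝ) : IsProbabilityMeasure (meanCovLimit S) := by
  have := Measure.isProbabilityMeasure_map (μ := wignerLaw d)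
    (continuous_conjSqrt S).measurable.aemeasurable
  unfold meanCovLimit
  infer_instance

/-- One sample limit variable `Z₁ = ½ D²Φ[(g, 0, G, 0), (g, 0, G, 0)]` at `(μ, μ, S, S)`. -/
def limitOne {d : ℕ} (μ : Vec d) (S : SymMat d) (w : Vec d × SymMat d) : ℝ :=
  (1 / 2) * secondDerivΦ d (μ, μ, S, S) (w.1, 0, w.2, 0)

/-- Two sample limit variable `Z₂ = ½ D²Φ[(g, g', G, G'), (g, g', G, G')]` at `(μ, μ, S, S)`. -/
def limitTwo {d : ℕ} (μ : Vec d) (S : SymMat d)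
    (w : (Vec d × SymMat d) × (Vec d × SymMat d)) : ℝ :=
  (1 / 2) * secondDerivΦ d (μ, μ, S, S) (w.1.1, w.2.1, w.1.2, w.2.2)

end GaussianWasserstein

end

open GaussianWasserstein

/-! The squared 2-Wasserstein distance between two Gaussian laws equals `Φ` of their parameters
(Gelbrich's formula). This also covers singular covariances, so for every `n` both estimators are
`Φ` evaluated at empirical parameters. The lower bound is Kantorovich duality with quadratic
potentials. The upper bound is a coupling driven by a single standard Gaussian vector, whose
orthogonal factor comes from a polar decomposition.

As a squared distance, `Φ` is nonnegative at positive definite arguments, and it vanishes at `θ =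
(μ, μ, S, S)`. It is smooth there because the matrix square root is a local inverse of squaring.
Hence `θ` is a critical point, and the second order delta method turns a central limit theorem for
mean and covariance into convergence of `n Φ(Tₙ)` to half the Hessian form at the Gaussian limit.

For that central limit theorem write `x = μ + S^{1/2} z` with `z` standard normal. The centred pair
`(x - μ, (x - μ)(x - μ)ᵗ - S)` is a linear image of the Hermite products `zᵢ` and `zᵢ zⱼ - δᵢⱼ`.
These are orthogonal, with variance 2 for `zᵢ² - 1` and 1 otherwise; this is the origin of the law
of `H`. Replacing the true mean by the sample mean and `n` by `n - 1` is negligible by Slutsky.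

The limit law charges every nonempty open set, and the Hessian form is continuous and not constant,
since along mean shifts half of it is `‖g‖²`. So neither limit is degenerate. -/

/-! ### Convergence in distribution: constant limits and independent pairs. -/

section Convergence

variable {Ω Ω' Ω'' : Type*} [MeasurableSpace Ω] [MeasurableSpace Ω'] [MeasurableSpace Ω'']
  {P : Measure Ω} {P' : Measure Ω'} {P'' : Measure Ω''}
  [IsProbabilityMeasure P] [IsProbabilityMeasure P'] [IsProbabilityMeasure P'']

/-- Convergence in distribution to a constant implies convergence in probability. -/
theorem tendstoInMeasure_of_tendstoInDistribution_const {E : Type*} [NormedAddCommGroup E]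
    [MeasurableSpace E] [BorelSpace E] {X : ℕ → Ω → E} {c : E}
    (h : TendstoInDistribution X atTop (fun _ : Ω' => c) (fun _ => P) P') :
    TendstoInMeasure P X atTop (fun _ => c) := by
  rw [tendstoInMeasure_iff_norm]
  intro ε hε
  have hF : IsClosed {x : E | ε ≤ ‖x - c‖} :=
    isClosed_le continuous_const (by fun_prop)
  -- Portmanteau for the closed set outside the `ε`-ball, which is null for the limit.
  have h1 := ProbabilityMeasure.limsup_measure_closed_le_of_tendsto h.tendsto hF
  have h2 : (Measure.map (fun _ : Ω' => c) P') {x : E | ε ≤ ‖x - c‖} = 0 := by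
    rw [Measure.map_apply (by fun_prop) hF.measurableSet]
    simp [hε.not_ge]
  have h3 : ∀ n, P {ω | ε ≤ ‖X n ω - c‖} = (P.map (X n)) {x : E | ε ≤ ‖x - c‖} := fun n => by
    rw [Measure.map_apply_of_aemeasurable (h.forall_aemeasurable n) hF.measurableSet]
    rfl
  simp_rw [h3]
  refine tendsto_of_le_liminf_of_limsup_le zero_le (h1.trans h2.le)

/-- Joint convergence in distribution of independent sequences. -/
theorem TendstoInDistribution.prodMk_of_indepFun {E F : Type*} [NormedAddCommGroup E]
    [MeasurableSpace E] [BorelSpace E] [SecondCountableTopology E] [NormedAddCommGroup F]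
    [MeasurableSpace F] [BorelSpace F] [SecondCountableTopology F]
    {X : ℕ → Ω → E} {Y : ℕ → Ω → F} {Z : Ω' → E} {W : Ω'' → F}
    (hX : TendstoInDistribution X atTop Z (fun _ => P) P')
    (hY : TendstoInDistribution Y atTop W (fun _ => P) P'')
    (hXY : ∀ n, IndepFun (X n) (Y n) P) :
    TendstoInDistribution (fun n ω => (X n ω, Y n ω)) atTop
      (fun w : Ω' × Ω'' => (Z w.1, W w.2)) (fun _ => P) (P'.prod P'') where
  forall_aemeasurable n := (hX.forall_aemeasurable n).prodMk (hY.forall_aemeasurable n)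
  aemeasurable_limit := hX.aemeasurable_limit.comp_fst.prodMk hY.aemeasurable_limit.comp_snd
  tendsto := by
    -- Independence makes each joint law a product of marginals, and forming products is weakly
    -- continuous.
    have h := (ProbabilityMeasure.continuous_prod (α := E) (β := F)).tendsto _ |>.comp
      (hX.tendsto.prodMk_nhds hY.tendsto)
    refine (h.congr fun n => ?_).trans (le_of_eq (congrArg 𝓝 ?_))
    · refine Subtype.ext ?_
      exact ((indepFun_iff_map_prod_eq_prod_map_map (hX.forall_aemeasurable n)
        (hY.forall_aemeasurable n)).1 (hXY n)).symm
    · refine Subtype.ext ?_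
      refine Eq.trans ?_ ((indepFun_iff_map_prod_eq_prod_map_map hX.aemeasurable_limit.comp_fst
        hY.aemeasurable_limit.comp_snd).1
        (indepFun_prod₀ hX.aemeasurable_limit hY.aemeasurable_limit)).symm
      have h1 : (P'.prod P'').map (fun w => Z w.1) = P'.map Z := by
        rw [show (fun w : Ω' × Ω'' => Z w.1) = Z ∘ Prod.fst from rfl,
          ← AEMeasurable.map_map_of_aemeasurable (by simpa using hX.aemeasurable_limit)
            measurable_fst.aemeasurable]
        simp
      have h2 : (P'.prod P'').map (fun w => W w.2) = P''.map W := by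
        rw [show (fun w : Ω' × Ω'' => W w.2) = W ∘ Prod.snd from rfl,
          ← AEMeasurable.map_map_of_aemeasurable (by simpa using hY.aemeasurable_limit)
            measurable_snd.aemeasurable]
        simp
      rw [h1, h2]
      rfl

end Convergence

/-! ### Finite dimensional central limit theorem. -/

section CLT

/-- The Cramér–Wold device: a vector frequency `t` becomes frequency 1 of a scalar projection, to
which the one dimensional theorem applies. -/
theorem charFun_map_eq_charFun_inner_map {Ω : Type*} [MeasurableSpace Ω]
    {P : Measure Ω} {E : Type*} [NormedAddCommGroup E]
    [InnerProductSpace ℝ E] [MeasurableSpace E] [BorelSpace E] [SecondCountableTopology E]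
    {U : Ω → E} (hU : AEMeasurable U P) (t : E) :
    charFun (P.map U) t = charFun (P.map fun ω => inner ℝ t (U ω)) 1 := by
  have h : AEMeasurable (fun ω => inner ℝ t (U ω)) P :=
    (innerSL ℝ t).continuous.measurable.comp_aemeasurable hU
  rw [charFun_apply, charFun_apply, integral_map hU (by fun_prop), integral_map h (by fun_prop)]
  simp [real_inner_comm]

variable {Ω Ω' : Type*} [MeasurableSpace Ω] [MeasurableSpace Ω']
  {P : Measure Ω} {P' : Measure Ω'} [IsProbabilityMeasure P] [IsProbabilityMeasure P']

/-- Central limit theorem in a finite dimensional normed space, for centered variables. -/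
theorem tendstoInDistribution_inv_sqrt_smul_sum {F : Type*} [NormedAddCommGroup F]
    [NormedSpace ℝ F] [FiniteDimensional ℝ F] [MeasurableSpace F] [BorelSpace F]
    {W : ℕ → Ω → F} {Z : Ω' → F} (hZ : AEMeasurable Z P')
    (hindep : iIndepFun W P) (hident : ∀ i, IdentDistrib (W i) (W 0) P P)
    (hmem : ∀ L : StrongDual ℝ F, MemLp (fun ω => L (W 0 ω)) 2 P)
    (hmean : ∀ L : StrongDual ℝ F, ∫ ω, L (W 0 ω) ∂P = 0)
    (hlaw : ∀ L : StrongDual ℝ F,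
      HasLaw (fun ω => L (Z ω)) (gaussianReal 0 Var[fun ω => L (W 0 ω); P].toNNReal) P') :
    TendstoInDistribution (fun (n : ℕ) ω => (√n)⁻¹ • ∑ i ∈ Finset.range n, W i ω) atTop Z
      (fun _ => P) P' := by
  have hW : ∀ i, AEMeasurable (W i) P := fun i => (hident i).aemeasurable_fst
  let e : F ≃L[ℝ] EuclideanSpace ℝ (Fin (Module.finrank ℝ F)) := toEuclidean
  have hS : ∀ n : ℕ, AEMeasurable (fun ω => (√n)⁻¹ • ∑ i ∈ Finset.range n, W i ω) P := by
    have : SecondCountableTopology F := e.toHomeomorph.secondCountableTopology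
    exact fun n => (Finset.aemeasurable_fun_sum _ fun i _ => hW i).const_smul _
  have key : TendstoInDistribution
      (fun (n : ℕ) => e ∘ fun ω => (√n)⁻¹ • ∑ i ∈ Finset.range n, W i ω) atTop (e ∘ Z)
      (fun _ => P) P' := by
    refine ⟨fun n => e.continuous.measurable.comp_aemeasurable (hS n),
      e.continuous.measurable.comp_aemeasurable hZ, ?_⟩
    refine ProbabilityMeasure.tendsto_iff_tendsto_charFun.2 fun t => ?_
    let L : StrongDual ℝ F := (innerSL ℝ t).comp (e : F →L[ℝ] _)
    have hclt := tendstoInDistribution_inv_sqrt_mul_sum_sub (X := fun i ω => L (W i ω))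
      (hlaw L) (hmem L) (hindep.comp (fun _ => L) fun _ => L.continuous.measurable)
      (fun i => (hident i).comp L.continuous.measurable)
    have hch := ProbabilityMeasure.tendsto_iff_tendsto_charFun.1 hclt.tendsto 1
    simp only [ProbabilityMeasure.coe_mk] at hch ⊢
    rw [charFun_map_eq_charFun_inner_map (e.continuous.measurable.comp_aemeasurable hZ)]
    convert! hch using 2 with n
    · rw [charFun_map_eq_charFun_inner_map (e.continuous.measurable.comp_aemeasurable (hS n))]
      congr 2
      ext ω
      change L _ = _
      simp only [hmean L, mul_zero, sub_zero, map_smul, map_sum, smul_eq_mul]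
  have := key.continuous_comp e.symm.continuous
  simpa [Function.comp_def] using this

end CLT

/-! ### Second order Taylor expansion. -/

section Taylor

variable {E : Type*} [NormedAddCommGroup E] [NormedSpace ℝ E]

/-- Second order Taylor expansion at a critical point, with Peano remainder. -/
theorem ContDiffAt.isLittleO_second_order {f : E → ℝ} {x : E} (hf : ContDiffAt ℝ 2 f x)
    (h0 : fderiv ℝ f x = 0) :
    (fun h => f (x + h) - f x - (1 / 2) * fderiv ℝ (fderiv ℝ f) x h h) =o[𝓝 0]
      fun h => ‖h‖ ^ 2 := by
  set B := fderiv ℝ (fderiv ℝ f) x with hB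
  have hsymm : ∀ v w, B v w = B w v :=
    (hf.isSymmSndFDerivAt (by simp)).eq
  have hdiff : ∀ᶠ y in 𝓝 x, DifferentiableAt ℝ f y := by
    filter_upwards [hf.eventually (by simp)] with y hy using hy.differentiableAt (by simp)
  have hd2 : HasFDerivAt (fderiv ℝ f) B x :=
    ((hf.fderiv_right (m := 1) (by norm_num)).differentiableAt (by simp)).hasFDerivAt
  have hlo : (fun h => fderiv ℝ f (x + h) - B h) =o[𝓝 0] fun h => h := by
    have := hasFDerivAt_iff_isLittleO_nhds_zero.1 hd2
    simpa [h0] using this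
  rw [Asymptotics.isLittleO_iff]
  intro c hc
  have h1 := (Asymptotics.isLittleO_iff.1 hlo) hc
  have h2 : ∀ᶠ h in 𝓝 (0 : E), DifferentiableAt ℝ f (x + h) := by
    have : Tendsto (fun h => x + h) (𝓝 0) (𝓝 x) := by
      simpa using (continuous_const.add continuous_id).tendsto (x := (0 : E)) (f := fun h => x + h)
    exact this.eventually hdiff
  obtain ⟨r, hr, hball⟩ := Metric.eventually_nhds_iff_ball.1 (h1.and h2)
  filter_upwards [Metric.ball_mem_nhds (0 : E) hr] with h hh
  -- By symmetry of `B` the derivative of `g` at `k` is `fderiv ℝ f (x + k) - B k`, of norm at most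
  -- `c ‖h‖` on the ball of radius `‖h‖`. The mean value inequality then bounds the remainder by `c
  -- ‖h‖²`.
  let g : E → ℝ := fun k => f (x + k) - (1 / 2) * B k k
  have hg : ∀ k ∈ Metric.closedBall (0 : E) ‖h‖,
      HasFDerivWithinAt g (fderiv ℝ f (x + k) - B k) (Metric.closedBall 0 ‖h‖) k := by
    intro k hk
    have hk' : k ∈ Metric.ball (0 : E) r := by
      simp only [mem_ball_zero_iff, mem_closedBall_zero_iff] at *
      exact hk.trans_lt hh
    have e1 : HasFDerivAt (fun k => f (x + k)) (fderiv ℝ f (x + k)) k := by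
      have := (hball k hk').2.hasFDerivAt.comp k ((hasFDerivAt_id k).const_add x)
      exact this.congr_fderiv (by ext; simp)
    have e2 : HasFDerivAt (fun k => B k k) (B k + B.flip k) k :=
      (B.hasFDerivAt.clm_apply (hasFDerivAt_id k)).congr_fderiv (by ext; simp)
    have e3 := e1.sub (e2.const_mul (1 / 2))
    refine (e3.congr_fderiv ?_).hasFDerivWithinAt
    ext v
    simp [hsymm v k]
    ring
  have hbound : ∀ k ∈ Metric.closedBall (0 : E) ‖h‖, ‖fderiv ℝ f (x + k) - B k‖ ≤ c * ‖h‖ := by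
    intro k hk
    have hk' : k ∈ Metric.ball (0 : E) r := by
      simp only [mem_ball_zero_iff, mem_closedBall_zero_iff] at *
      exact hk.trans_lt hh
    refine ((hball k hk').1).trans ?_
    simp only [mem_closedBall_zero_iff] at hk
    gcongr
  have := (convex_closedBall (0 : E) ‖h‖).norm_image_sub_le_of_norm_hasFDerivWithin_le hg hbound
    (Metric.mem_closedBall_self (norm_nonneg _)) (show h ∈ Metric.closedBall 0 ‖h‖ by simp)
  have e : g h - g 0 = f (x + h) - f x - (1 / 2) * B h h := by simp [g]; ring
  rw [e] at this
  simpa [pow_two, mul_assoc] using this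

end Taylor

/-! ### Second order delta method. -/

section Delta

variable {Ω Ω' : Type*} [MeasurableSpace Ω] [MeasurableSpace Ω']
  {P : Measure Ω} {P' : Measure Ω'} [IsProbabilityMeasure P] [IsProbabilityMeasure P']

/-- Second order delta method at a critical zero of `f`. -/
theorem tendstoInDistribution_second_order_delta {E : Type*} [NormedAddCommGroup E]
    [NormedSpace ℝ E] [SecondCountableTopology E] [MeasurableSpace E] [BorelSpace E]
    {f : E → ℝ} {θ : E} (hfm : Measurable f) (hf : ContDiffAt ℝ 2 f θ) (hf0 : f θ = 0)
    (hdf : fderiv ℝ f θ = 0) {T : ℕ → Ω → E} {Z : Ω' → E} (hT : ∀ n, AEMeasurable (T n) P)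
    (hTZ : TendstoInDistribution (fun (n : ℕ) ω => √n • (T n ω - θ)) atTop Z (fun _ => P) P') :
    TendstoInDistribution (fun (n : ℕ) ω => (n : ℝ) * f (T n ω)) atTop
      (fun w => (1 / 2) * fderiv ℝ (fderiv ℝ f) θ (Z w) (Z w)) (fun _ => P) P' := by
  set B := fderiv ℝ (fderiv ℝ f) θ with hB
  let Q : E → ℝ := fun h => (1 / 2) * B h h
  have hQc : Continuous Q := by
    have : Continuous fun h => B h h := B.continuous.clm_apply continuous_id
    exact continuous_const.mul this
  -- Normalised Taylor remainder. Division by zero gives `R 0 = 0`, so `R` tends to 0 along the full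
  -- neighbourhood filter.
  let R : E → ℝ := fun h => (f (θ + h) - Q h) / ‖h‖ ^ 2
  have hRm : Measurable R :=
    ((hfm.comp (measurable_const.add measurable_id)).sub hQc.measurable).div
      (measurable_norm.pow_const 2)
  have hR0 : Tendsto R (𝓝 0) (𝓝 0) := by
    have := (hf.isLittleO_second_order hdf).tendsto_div_nhds_zero
    simpa [R, Q, hf0] using this
  have hRid : ∀ h, f (θ + h) = Q h + R h * ‖h‖ ^ 2 := by
    intro h
    by_cases hh : h = 0
    · subst hh; simp [Q, R, hf0]
    · have : ‖h‖ ^ 2 ≠ 0 := by simpa using hh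
      simp only [R]; field_simp; ring
  -- Consistency: the deviation is the convergent sequence times `1/√n`.
  have hsmall : TendstoInMeasure P (fun n ω => T n ω - θ) atTop (fun _ => 0) := by
    have hs : TendstoInDistribution (fun (n : ℕ) ω => (√n)⁻¹ • (√n • (T n ω - θ))) atTop
        (fun _ : Ω' => (0 : E)) (fun _ => P) P' := by
      have hc : TendstoInMeasure P (fun (n : ℕ) (_ : Ω) => (√n)⁻¹) atTop
          (fun _ => (0 : ℝ)) := by
        refine tendstoInMeasure_of_tendsto_ae (fun n => aestronglyMeasurable_const) ?_
        refine ae_of_all _ fun ω => ?_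
        exact tendsto_inv_atTop_zero.comp
          (Real.tendsto_sqrt_atTop.comp tendsto_natCast_atTop_atTop)
      have := hTZ.continuous_comp_prodMk_of_tendstoInMeasure_const
        (g := fun p : E × ℝ => p.2 • p.1) (by fun_prop) hc (fun n => aemeasurable_const)
      simpa using this
    have h0 := tendstoInMeasure_of_tendstoInDistribution_const hs
    refine h0.congr' ?_ (ae_of_all _ fun _ => rfl)
    filter_upwards [eventually_gt_atTop 0] with n hn
    refine ae_of_all _ fun ω => ?_
    have : √(n : ℝ) ≠ 0 := by positivity
    simp [smul_smul, inv_mul_cancel₀ this]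
  have hRsmall : TendstoInMeasure P (fun n ω => R (T n ω - θ)) atTop (fun _ => 0) := by
    rw [tendstoInMeasure_iff_norm] at hsmall ⊢
    intro ε hε
    obtain ⟨δ, hδ, hball⟩ := Metric.eventually_nhds_iff_ball.1
      (Metric.tendsto_nhds.1 hR0 ε hε)
    refine tendsto_of_tendsto_of_tendsto_of_le_of_le tendsto_const_nhds (hsmall δ hδ)
      (fun _ => zero_le) fun n => measure_mono fun ω hω => ?_
    by_contra hlt
    simp only [Set.mem_ofPred_eq, not_le, sub_zero] at hω hlt
    have := hball (T n ω - θ) (by simpa using hlt)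
    rw [dist_zero_right] at this
    exact absurd hω this.not_ge
  -- Slutsky: with `h = T n ω - θ`, `n f(θ + h) = Q(√n h) + R(h) ‖√n h‖²`, and `R(h)` tends to 0 in
  -- probability.
  have hfin := hTZ.continuous_comp_prodMk_of_tendstoInMeasure_const
    (g := fun p : E × ℝ => Q p.1 + p.2 * ‖p.1‖ ^ 2)
    ((hQc.comp continuous_fst).add (by fun_prop)) hRsmall
    (fun n => hRm.comp_aemeasurable ((hT n).sub_const θ))
  refine hfin.congr (fun n => ae_of_all _ fun ω => ?_) (ae_of_all _ fun w => ?_)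
  · have h1 := hRid (T n ω - θ)
    rw [add_sub_cancel] at h1
    have hn : √(n : ℝ) * √n = n := Real.mul_self_sqrt (Nat.cast_nonneg n)
    simp only [h1, Q, map_smul, smul_apply, smul_eq_mul, norm_smul,
      Real.norm_eq_abs, abs_of_nonneg (Real.sqrt_nonneg _), mul_pow]
    rw [Real.sq_sqrt (Nat.cast_nonneg n)]
    linear_combination (1 / 2 * (B (T n ω - θ)) (T n ω - θ)) * hn
  · simp [Q]

end Delta

/-! ### Smoothness and measurability of the matrix square root. -/

section SquareRoot

variable {d : ℕ}

/-- If `A ≥ r` with `r > 0`, then `B ≥ A - ‖A - B‖ ≥ r - ‖A - B‖ > 0` for `B` in the ball of radius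
`r`. The zero dimensional case is separate because the spectrum is then empty. -/
theorem isOpen_posDef : IsOpen {A : SymMat d | (A : Matrix (Fin d) (Fin d) ℝ).PosDef} := by
  rw [Metric.isOpen_iff]
  intro A hA
  have hA' : IsStrictlyPositive (A : Matrix (Fin d) (Fin d) ℝ) :=
    Matrix.isStrictlyPositive_iff_posDef.2 hA
  rcases subsingleton_or_nontrivial (Matrix (Fin d) (Fin d) ℝ) with hsub | hnt
  · refine ⟨1, one_pos, fun B _ => ?_⟩
    rwa [Set.mem_ofPred_eq, Subsingleton.elim (B : Matrix (Fin d) (Fin d) ℝ) A]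
  obtain ⟨r, hr, hrA⟩ := (CFC.exists_pos_algebraMap_le_iff (A := Matrix (Fin d) (Fin d) ℝ)
    A.2).2 fun x hx => hA'.spectrum_pos hx
  refine ⟨r, hr, fun B hB => ?_⟩
  rw [Metric.mem_ball, dist_eq_norm, ← norm_neg, neg_sub] at hB
  have h1 : (A - B : Matrix (Fin d) (Fin d) ℝ) ≤ algebraMap ℝ _ ‖A - B‖ :=
    le_algebraMap_of_spectrum_le (ha := (A - B).2) fun r hr =>
      (Real.le_norm_self r).trans (spectrum.norm_le_norm_of_mem hr)
  have hpos : (algebraMap ℝ (Matrix (Fin d) (Fin d) ℝ) (r - ‖A - B‖)).PosDef := by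
    rw [Algebra.algebraMap_eq_smul_one]
    exact Matrix.PosDef.one.smul (sub_pos.2 hB)
  have h2 : ((B : Matrix (Fin d) (Fin d) ℝ) - algebraMap ℝ _ (r - ‖A - B‖)).PosSemidef := by
    have := (Matrix.le_iff.1 hrA).add (Matrix.le_iff.1 h1)
    have e : (B : Matrix (Fin d) (Fin d) ℝ) - algebraMap ℝ _ (r - ‖A - B‖) =
        (A - algebraMap ℝ _ r) + (algebraMap ℝ _ ‖A - B‖ - (A - B)) := by
      rw [map_sub]; abel
    rwa [e]
  have := hpos.add_posSemidef h2
  rwa [add_sub_cancel] at this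

/-- The symmetric part of a matrix, as a continuous linear map. -/
noncomputable def symPart (d : ℕ) : Matrix (Fin d) (Fin d) ℝ →L[ℝ] SymMat d :=
  LinearMap.toContinuousLinearMap
    (selfAdjointPart ℝ : Matrix (Fin d) (Fin d) ℝ →ₗ[ℝ] selfAdjoint (Matrix (Fin d) (Fin d) ℝ))

theorem coe_symPart {M : Matrix (Fin d) (Fin d) ℝ} (hM : IsSelfAdjoint M) :
    (symPart d M : Matrix (Fin d) (Fin d) ℝ) = M :=
  hM.coe_selfAdjointPart_apply ℝ

/-- The square root as a map on symmetric matrices. -/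
noncomputable def sqrtSym (A : SymMat d) : SymMat d :=
  ⟨CFC.sqrt (A : Matrix (Fin d) (Fin d) ℝ), (CFC.sqrt_nonneg _).isSelfAdjoint⟩

theorem coe_sqrtSym (A : SymMat d) :
    (sqrtSym A : Matrix (Fin d) (Fin d) ℝ) = CFC.sqrt (A : Matrix (Fin d) (Fin d) ℝ) := rfl

theorem posDef_sqrt {A : Matrix (Fin d) (Fin d) ℝ} (hA : A.PosDef) : (CFC.sqrt A).PosDef :=
  Matrix.isStrictlyPositive_iff_posDef.1
    (IsStrictlyPositive.sqrt A (Matrix.isStrictlyPositive_iff_posDef.2 hA))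

/-- Injectivity of the Lyapunov operator, the derivative of squaring at `X`. Multiplying by `H` and
taking traces gives `tr (H X H) = 0`; since `H X H = (X^{1/2} H)ᵗ (X^{1/2} H)` is positive
semidefinite, `X^{1/2} H = 0`. -/
theorem eq_zero_of_mul_add_mul_eq_zero {X H : Matrix (Fin d) (Fin d) ℝ} (hX : X.PosDef)
    (hH : IsSelfAdjoint H) (h : X * H + H * X = 0) : H = 0 := by
  have hH' : H.conjTranspose = H := hH
  have hpsd : (H.conjTranspose * X * H).PosSemidef := hX.posSemidef.conjTranspose_mul_mul_same H
  have htr : (H.conjTranspose * X * H).trace = 0 := by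
    have h1 : (H * (X * H + H * X)).trace = 0 := by rw [h]; simp
    rw [mul_add, Matrix.trace_add, ← mul_assoc, ← mul_assoc, Matrix.trace_mul_comm (H * H) X,
      ← mul_assoc, Matrix.trace_mul_comm (X * H) H, ← mul_assoc] at h1
    rw [hH']; linarith
  have h0 := hpsd.trace_eq_zero_iff.1 htr
  have h2 : CFC.sqrt X * H = 0 := by
    rw [← Matrix.conjTranspose_mul_self_eq_zero, Matrix.conjTranspose_mul,
      (posDef_sqrt hX).isHermitian.eq, ← h0]
    conv_rhs => rw [← CFC.sqrt_mul_sqrt_self X hX.posSemidef.nonneg]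
    simp only [mul_assoc]
  exact (posDef_sqrt hX).isUnit.mul_right_eq_zero.1 h2

/-- Inverse function theorem for `X ↦ X²` on symmetric matrices. The derivative at `A^{1/2}` is an
injective endomorphism of a finite dimensional space, hence invertible. -/
theorem contDiffAt_sqrtSym {A : SymMat d} (hA : (A : Matrix (Fin d) (Fin d) ℝ).PosDef)
    {n : WithTop ℕ∞} (hn : n ≠ 0) : ContDiffAt ℝ n (sqrtSym (d := d)) A := by
  let ι : SymMat d →L[ℝ] Matrix (Fin d) (Fin d) ℝ := Submodule.subtypeL _
  let f : SymMat d → SymMat d := fun X => symPart d (ι X * ι X)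
  have hf : ContDiff ℝ n f := (symPart d).contDiff.comp (ι.contDiff.mul ι.contDiff)
  set X₀ := sqrtSym A with hX₀
  have hX₀pd : (X₀ : Matrix (Fin d) (Fin d) ℝ).PosDef := posDef_sqrt hA
  have hfX₀ : f X₀ = A := by
    refine Subtype.ext ?_
    have : IsSelfAdjoint (ι X₀ * ι X₀) := by
      have h : IsSelfAdjoint (ι X₀) := X₀.2
      rw [IsSelfAdjoint, star_mul, h.star_eq]
    rw [coe_symPart this]
    exact CFC.sqrt_mul_sqrt_self _ hA.posSemidef.nonneg
  obtain ⟨f', hf', hval⟩ : ∃ f' : SymMat d →L[ℝ] SymMat d, HasFDerivAt f f' X₀ ∧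
      ∀ H, f' H = symPart d (ι X₀ * ι H + ι H * ι X₀) :=
    ⟨_, (symPart d).hasFDerivAt.comp X₀ ((ι.hasFDerivAt (x := X₀)).mul' (ι.hasFDerivAt (x := X₀))),
      fun H => by simp⟩
  have hinj : Function.Injective f'.toLinearMap := by
    rw [← LinearMap.ker_eq_bot, LinearMap.ker_eq_bot']
    intro H hH
    have hsa : IsSelfAdjoint (ι X₀ * ι H + ι H * ι X₀) := by
      have h1 : IsSelfAdjoint (ι X₀) := X₀.2
      have h2 : IsSelfAdjoint (ι H) := H.2
      rw [IsSelfAdjoint, star_add, star_mul, star_mul, h1.star_eq, h2.star_eq, add_comm]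
    have h0 : (symPart d (ι X₀ * ι H + ι H * ι X₀) : Matrix (Fin d) (Fin d) ℝ) = 0 := by
      rw [← hval]; exact congrArg Subtype.val hH
    rw [coe_symPart hsa] at h0
    exact Subtype.ext (eq_zero_of_mul_add_mul_eq_zero hX₀pd H.2 h0)
  let e : SymMat d ≃L[ℝ] SymMat d :=
    (LinearEquiv.ofInjectiveEndo f'.toLinearMap hinj).toContinuousLinearEquiv
  have he : HasFDerivAt f (e : SymMat d →L[ℝ] SymMat d) X₀ := hf'.congr_fderiv (by ext; rfl)
  -- The square root inverts squaring on the open set of positive definite matrices, so it coincides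
  -- with the abstract local inverse near `A`.
  have hleft : ∀ᶠ X in 𝓝 X₀, sqrtSym (f X) = X := by
    filter_upwards [isOpen_posDef.mem_nhds hX₀pd] with X hX
    refine Subtype.ext ?_
    have : IsSelfAdjoint (ι X * ι X) := by
      have h : IsSelfAdjoint (ι X) := X.2
      rw [IsSelfAdjoint, star_mul, h.star_eq]
    rw [coe_sqrtSym, coe_symPart this]
    exact CFC.sqrt_mul_self _ (Matrix.PosDef.posSemidef hX).nonneg
  have hloc := (hf.contDiffAt.hasStrictFDerivAt' he hn).localInverse_unique hleft
  have := hf.contDiffAt.to_localInverse he hn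
  rw [hfX₀] at this hloc
  exact this.congr_of_eventuallyEq hloc

/-- The square root is continuous on the closed positive semidefinite cone and takes the default
value 0 outside it. The delta method asks for measurability on the whole space. -/
theorem measurable_sqrtSym : Measurable (sqrtSym (d := d)) := by
  classical
  have hclosed : IsClosed {A : SymMat d | 0 ≤ (A : Matrix (Fin d) (Fin d) ℝ)} := by
    have : {A : SymMat d | 0 ≤ (A : Matrix (Fin d) (Fin d) ℝ)} =
        ⋂ x : Fin d → ℝ, {A : SymMat d | 0 ≤ x ⬝ᵥ (A : Matrix (Fin d) (Fin d) ℝ).mulVec x} := by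
      ext A
      simp only [Set.mem_ofPred_eq, Set.mem_iInter]
      rw [Matrix.nonneg_iff_posSemidef, Matrix.posSemidef_iff_dotProduct_mulVec]
      exact ⟨fun h x => h.2 x, fun h => ⟨A.2, h⟩⟩
    rw [this]
    exact isClosed_iInter fun x => isClosed_le continuous_const (by fun_prop)
  have hcont : ContinuousOn (sqrtSym (d := d))
      {A : SymMat d | 0 ≤ (A : Matrix (Fin d) (Fin d) ℝ)} :=
    IsInducing.subtypeVal.continuousOn_iff.2
      (CFC.continuousOn_sqrt.comp continuous_subtype_val.continuousOn fun _ h => h)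
  have : sqrtSym (d := d) = Set.piecewise {A : SymMat d | 0 ≤ (A : Matrix (Fin d) (Fin d) ℝ)}
      sqrtSym 0 := by
    ext1 A
    by_cases hA : 0 ≤ (A : Matrix (Fin d) (Fin d) ℝ)
    · rw [Set.piecewise_eq_of_mem _ _ _ (by exact hA)]
    · rw [Set.piecewise_eq_of_notMem _ _ _ (by exact hA)]
      exact Subtype.ext (CFC.sqrt_of_not_nonneg hA)
  rw [this]
  exact hcont.measurable_piecewise continuousOn_const hclosed.measurableSet

end SquareRoot

/-! ### Regularity of the functional. -/

section Functional

variable {d : ℕ}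

/-- Expresses `Φ` through maps between spaces of symmetric matrices, so that regularity of `sqrtSym`
can be composed; `symPart` acts here on a symmetric matrix. -/
theorem Φ_eq (θ : Vec d × Vec d × SymMat d × SymMat d) :
    Φ d θ = ‖θ.1 - θ.2.1‖ ^ 2 + (θ.2.2.1 : Matrix (Fin d) (Fin d) ℝ).trace
      + (θ.2.2.2 : Matrix (Fin d) (Fin d) ℝ).trace
      - 2 * (sqrtSym (symPart d ((sqrtSym θ.2.2.1 : Matrix (Fin d) (Fin d) ℝ) * θ.2.2.2 *
        (sqrtSym θ.2.2.1 : Matrix (Fin d) (Fin d) ℝ))) : Matrix (Fin d) (Fin d) ℝ).trace := by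
  have h : IsSelfAdjoint ((sqrtSym θ.2.2.1 : Matrix (Fin d) (Fin d) ℝ) * θ.2.2.2 *
      (sqrtSym θ.2.2.1 : Matrix (Fin d) (Fin d) ℝ)) := (conjSqrt _ θ.2.2.2).2
  rw [Φ, coe_sqrtSym, coe_symPart h, coe_sqrtSym]

/-- The trace as a continuous linear map on symmetric matrices. -/
noncomputable def traceSym (d : ℕ) : SymMat d →L[ℝ] ℝ :=
  LinearMap.toContinuousLinearMap
    (Matrix.traceLinearMap (Fin d) ℝ ℝ ∘ₗ (selfAdjoint.submodule ℝ _).subtype)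

theorem posDef_sqrt_mul_mul_sqrt {A B : Matrix (Fin d) (Fin d) ℝ} (hA : A.PosDef)
    (hB : B.PosDef) : (CFC.sqrt A * B * CFC.sqrt A).PosDef := by
  have h := hB.conjTranspose_mul_mul_same (B := CFC.sqrt A)
    (Matrix.mulVec_injective_of_isUnit (posDef_sqrt hA).isUnit)
  rwa [(posDef_sqrt hA).isHermitian.eq] at h

theorem contDiffAt_Φ {θ : Vec d × Vec d × SymMat d × SymMat d}
    (hA : (θ.2.2.1 : Matrix (Fin d) (Fin d) ℝ).PosDef)
    (hB : (θ.2.2.2 : Matrix (Fin d) (Fin d) ℝ).PosDef) {n : WithTop ℕ∞} (hn : n ≠ 0) :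
    ContDiffAt ℝ n (Φ d) θ := by
  have hs : ContDiffAt ℝ n (fun θ : Vec d × Vec d × SymMat d × SymMat d => sqrtSym θ.2.2.1) θ :=
    (contDiffAt_sqrtSym hA hn).comp θ (contDiff_snd.snd.fst.contDiffAt)
  let ι : SymMat d →L[ℝ] Matrix (Fin d) (Fin d) ℝ := Submodule.subtypeL _
  have hs' := ι.contDiff.contDiffAt.comp θ hs
  have hB' : ContDiffAt ℝ n (fun θ : Vec d × Vec d × SymMat d × SymMat d => ι θ.2.2.2) θ :=
    (ι.contDiff.comp contDiff_snd.snd.snd).contDiffAt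
  have hin := (symPart d).contDiff.contDiffAt.comp θ ((hs'.mul hB').mul hs')
  have hpd : (symPart d ((sqrtSym θ.2.2.1 : Matrix (Fin d) (Fin d) ℝ) * θ.2.2.2 *
        (sqrtSym θ.2.2.1 : Matrix (Fin d) (Fin d) ℝ)) : Matrix (Fin d) (Fin d) ℝ).PosDef := by
    have h : IsSelfAdjoint ((sqrtSym θ.2.2.1 : Matrix (Fin d) (Fin d) ℝ) * θ.2.2.2 *
      (sqrtSym θ.2.2.1 : Matrix (Fin d) (Fin d) ℝ)) := (conjSqrt _ θ.2.2.2).2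
    rw [coe_symPart h]
    exact posDef_sqrt_mul_mul_sqrt hA hB
  have hout := (traceSym d).contDiff.contDiffAt.comp θ ((contDiffAt_sqrtSym hpd hn).comp θ hin)
  have hnorm : ContDiffAt ℝ n (fun θ : Vec d × Vec d × SymMat d × SymMat d =>
      ‖θ.1 - θ.2.1‖ ^ 2) θ :=
    ((contDiff_fst.sub contDiff_snd.fst).norm_sq ℝ).contDiffAt
  have ht1 : ContDiffAt ℝ n (fun θ : Vec d × Vec d × SymMat d × SymMat d =>
      traceSym d θ.2.2.1) θ := ((traceSym d).contDiff.comp contDiff_snd.snd.fst).contDiffAt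
  have ht2 : ContDiffAt ℝ n (fun θ : Vec d × Vec d × SymMat d × SymMat d =>
      traceSym d θ.2.2.2) θ := ((traceSym d).contDiff.comp contDiff_snd.snd.snd).contDiffAt
  have := ((hnorm.add ht1).add ht2).sub ((contDiffAt_const (c := (2 : ℝ))).mul hout)
  exact this.congr_of_eventuallyEq (Eventually.of_forall Φ_eq)

theorem measurable_Φ : Measurable (Φ d) := by
  have hs : Measurable (fun θ : Vec d × Vec d × SymMat d × SymMat d => sqrtSym θ.2.2.1) :=
    measurable_sqrtSym.comp measurable_snd.snd.fst
  have hc : Continuous fun p : SymMat d × SymMat d =>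
      symPart d ((p.1 : Matrix (Fin d) (Fin d) ℝ) * p.2 * p.1) :=
    (symPart d).continuous.comp (by fun_prop)
  have h := (traceSym d).continuous.measurable.comp (measurable_sqrtSym.comp
    (hc.measurable.comp (hs.prodMk measurable_snd.snd.snd)))
  have hn : Measurable (fun θ : Vec d × Vec d × SymMat d × SymMat d => ‖θ.1 - θ.2.1‖ ^ 2) :=
    (measurable_fst.sub measurable_snd.fst).norm.pow_const 2
  have ht1 : Measurable (fun θ : Vec d × Vec d × SymMat d × SymMat d => traceSym d θ.2.2.1) :=
    (traceSym d).continuous.measurable.comp measurable_snd.snd.fst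
  have ht2 : Measurable (fun θ : Vec d × Vec d × SymMat d × SymMat d => traceSym d θ.2.2.2) :=
    (traceSym d).continuous.measurable.comp measurable_snd.snd.snd
  rw [show Φ d = _ from funext Φ_eq]
  exact ((hn.add ht1).add ht2).sub (h.const_mul 2)

end Functional

/-! ### Polar decomposition and the dual certificate. -/

section Polar

variable {d : ℕ}

theorem coe_sqrt_conjTranspose (A : Matrix (Fin d) (Fin d) ℝ) :
    (CFC.sqrt A).conjTranspose = CFC.sqrt A := (CFC.sqrt_nonneg A).isSelfAdjoint

theorem posSemidef_sqrt_mul_mul_sqrt (A : Matrix (Fin d) (Fin d) ℝ) {B : Matrix (Fin d) (Fin d) ℝ}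
    (hB : B.PosSemidef) : (CFC.sqrt A * B * CFC.sqrt A).PosSemidef := by
  have h := hB.conjTranspose_mul_mul_same (CFC.sqrt A)
  rwa [coe_sqrt_conjTranspose] at h

/-- Fitted covariances can be singular, so identities are proved for the positive definite shifts `A
+ 1/(n+1)` and passed to the limit. -/
theorem tendsto_sqrt_add_smul_one {A : Matrix (Fin d) (Fin d) ℝ} (hA : A.PosSemidef) :
    Tendsto (fun n : ℕ => CFC.sqrt (A + (1 / ((n : ℝ) + 1)) • 1)) atTop (𝓝 (CFC.sqrt A)) := by
  have h1 : Tendsto (fun n : ℕ => A + (1 / ((n : ℝ) + 1)) • (1 : Matrix (Fin d) (Fin d) ℝ))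
      atTop (𝓝 A) := by
    have := (tendsto_one_div_add_atTop_nhds_zero_nat (𝕜 := ℝ)).smul_const
      (1 : Matrix (Fin d) (Fin d) ℝ)
    simpa using tendsto_const_nhds.add this
  have h2 := CFC.continuousOn_sqrt (A := Matrix (Fin d) (Fin d) ℝ) A hA.nonneg
  refine h2.tendsto.comp (tendsto_nhdsWithin_iff.2 ⟨h1, Eventually.of_forall fun n => ?_⟩)
  exact (hA.add (Matrix.PosSemidef.one.smul (by positivity))).nonneg

theorem posDef_add_smul_one {A : Matrix (Fin d) (Fin d) ℝ} (hA : A.PosSemidef) (n : ℕ) :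
    (A + (1 / ((n : ℝ) + 1)) • 1).PosDef :=
  Matrix.PosDef.posSemidef_add hA (Matrix.PosDef.one.smul (by positivity))

theorem tendsto_sqrt_sqrt_mul_mul_sqrt {A B : Matrix (Fin d) (Fin d) ℝ} (hA : A.PosSemidef)
    (hB : B.PosSemidef) :
    Tendsto (fun n : ℕ => CFC.sqrt (CFC.sqrt (A + (1 / ((n : ℝ) + 1)) • 1) *
      (B + (1 / ((n : ℝ) + 1)) • 1) * CFC.sqrt (A + (1 / ((n : ℝ) + 1)) • 1))) atTop
      (𝓝 (CFC.sqrt (CFC.sqrt A * B * CFC.sqrt A))) := by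
  have h1 : Tendsto (fun n : ℕ => B + (1 / ((n : ℝ) + 1)) • (1 : Matrix (Fin d) (Fin d) ℝ))
      atTop (𝓝 B) := by
    have := (tendsto_one_div_add_atTop_nhds_zero_nat (𝕜 := ℝ)).smul_const
      (1 : Matrix (Fin d) (Fin d) ℝ)
    simpa using tendsto_const_nhds.add this
  have h2 := CFC.continuousOn_sqrt (A := Matrix (Fin d) (Fin d) ℝ) _
    (posSemidef_sqrt_mul_mul_sqrt A hB).nonneg
  have hs := tendsto_sqrt_add_smul_one hA
  refine h2.tendsto.comp (tendsto_nhdsWithin_iff.2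
    ⟨(hs.mul h1).mul hs, Eventually.of_forall fun n => ?_⟩)
  exact (posSemidef_sqrt_mul_mul_sqrt _ (posDef_add_smul_one hB n).posSemidef).nonneg

theorem exists_polar_of_posDef {A B : Matrix (Fin d) (Fin d) ℝ} (hA : A.PosDef) (hB : B.PosDef) :
    ∃ U : Matrix (Fin d) (Fin d) ℝ, U.conjTranspose * U = 1 ∧
      CFC.sqrt B * CFC.sqrt A = U * CFC.sqrt (CFC.sqrt A * B * CFC.sqrt A) := by
  set R := CFC.sqrt (CFC.sqrt A * B * CFC.sqrt A) with hR
  have hRpd : R.PosDef := posDef_sqrt (posDef_sqrt_mul_mul_sqrt hA hB)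
  have hRR : R * R = CFC.sqrt A * B * CFC.sqrt A :=
    CFC.sqrt_mul_sqrt_self _ (posSemidef_sqrt_mul_mul_sqrt A hB.posSemidef).nonneg
  have hdet : IsUnit R.det := (Matrix.isUnit_iff_isUnit_det R).1 hRpd.isUnit
  -- Forced by the required identity; orthogonality is `R⁻¹ R² R⁻¹ = 1`.
  refine ⟨CFC.sqrt B * CFC.sqrt A * R⁻¹, ?_, ?_⟩
  · rw [Matrix.conjTranspose_mul, Matrix.conjTranspose_mul, coe_sqrt_conjTranspose,
      coe_sqrt_conjTranspose, Matrix.conjTranspose_nonsing_inv, hRpd.isHermitian.eq]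
    calc R⁻¹ * (CFC.sqrt A * CFC.sqrt B) * (CFC.sqrt B * CFC.sqrt A * R⁻¹)
        = R⁻¹ * (CFC.sqrt A * (CFC.sqrt B * CFC.sqrt B) * CFC.sqrt A) * R⁻¹ := by
          simp only [mul_assoc]
      _ = R⁻¹ * R * (R * R⁻¹) := by
          rw [CFC.sqrt_mul_sqrt_self B hB.posSemidef.nonneg, ← hRR]; simp only [mul_assoc]
      _ = 1 := by rw [Matrix.nonsing_inv_mul _ hdet, Matrix.mul_nonsing_inv _ hdet, mul_one]
  · rw [mul_assoc, Matrix.nonsing_inv_mul _ hdet, mul_one]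

theorem isCompact_conjTranspose_mul_self_eq_one :
    IsCompact {U : Matrix (Fin d) (Fin d) ℝ | U.conjTranspose * U = 1} := by
  have : ProperSpace (Matrix (Fin d) (Fin d) ℝ) := FiniteDimensional.proper ℝ _
  refine Metric.isCompact_of_isClosed_isBounded ?_ ?_
  · exact isClosed_eq (by fun_prop) continuous_const
  -- The C*-identity gives `‖U‖² = ‖1‖`, whence `‖U‖ ≤ ‖1‖ + 1`, also in dimension zero.
  · refine isBounded_iff_forall_norm_le.2 ⟨‖(1 : Matrix (Fin d) (Fin d) ℝ)‖ + 1, fun U hU => ?_⟩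
    have h := Matrix.l2_opNorm_conjTranspose_mul_self U
    rw [show U.conjTranspose * U = 1 from hU] at h
    nlinarith [norm_nonneg U]

/-- Polar decomposition of `B^{1/2} A^{1/2}` for positive semidefinite `A`, `B`. -/
theorem exists_polar {A B : Matrix (Fin d) (Fin d) ℝ} (hA : A.PosSemidef) (hB : B.PosSemidef) :
    ∃ U : Matrix (Fin d) (Fin d) ℝ, U.conjTranspose * U = 1 ∧
      CFC.sqrt B * CFC.sqrt A = U * CFC.sqrt (CFC.sqrt A * B * CFC.sqrt A) := by
  choose U hU hUR using fun n : ℕ =>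
    exists_polar_of_posDef (posDef_add_smul_one hA n) (posDef_add_smul_one hB n)
  -- The orthogonal factors need not converge, but compactness gives a convergent subsequence.
  obtain ⟨V, hV, φ, hφ, hlim⟩ := isCompact_conjTranspose_mul_self_eq_one.tendsto_subseq hU
  refine ⟨V, hV, ?_⟩
  have h1 := ((tendsto_sqrt_add_smul_one hB).mul (tendsto_sqrt_add_smul_one hA)).comp
    hφ.tendsto_atTop
  have h2 := hlim.mul ((tendsto_sqrt_sqrt_mul_mul_sqrt hA hB).comp hφ.tendsto_atTop)
  refine tendsto_nhds_unique h1 (h2.congr fun n => ?_)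
  exact (hUR (φ n)).symm

/-- The dual certificate for the optimal transport between centered Gaussian measures. -/
theorem exists_dual_certificate {A B : Matrix (Fin d) (Fin d) ℝ} (hA : A.PosDef) (hB : B.PosDef) :
    ∃ T : Matrix (Fin d) (Fin d) ℝ, T.PosDef ∧ (T * A).trace + (T⁻¹ * B).trace =
      2 * (CFC.sqrt (CFC.sqrt A * B * CFC.sqrt A)).trace := by
  set R := CFC.sqrt (CFC.sqrt A * B * CFC.sqrt A) with hR
  set a := CFC.sqrt A with ha
  have hRpd : R.PosDef := posDef_sqrt (posDef_sqrt_mul_mul_sqrt hA hB)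
  have hapd : a.PosDef := posDef_sqrt hA
  have hRR : R * R = a * B * a :=
    CFC.sqrt_mul_sqrt_self _ (posSemidef_sqrt_mul_mul_sqrt A hB.posSemidef).nonneg
  have haa : a * a = A := CFC.sqrt_mul_sqrt_self _ hA.posSemidef.nonneg
  have hRdet : IsUnit R.det := (Matrix.isUnit_iff_isUnit_det R).1 hRpd.isUnit
  have hadet : IsUnit a.det := (Matrix.isUnit_iff_isUnit_det a).1 hapd.isUnit
  -- The matrix of the optimal transport map: it satisfies `T A T = B`.
  refine ⟨a⁻¹ * R * a⁻¹, ?_, ?_⟩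
  · have h := hRpd.conjTranspose_mul_mul_same (B := a⁻¹)
      (Matrix.mulVec_injective_of_isUnit hapd.inv.isUnit)
    rwa [hapd.inv.isHermitian.eq] at h
  · have h1 : (a⁻¹ * R * a⁻¹ * A).trace = R.trace := by
      rw [← haa, ← mul_assoc, mul_assoc (a⁻¹ * R), Matrix.nonsing_inv_mul _ hadet, mul_one,
        Matrix.trace_mul_comm, ← mul_assoc, Matrix.mul_nonsing_inv _ hadet, one_mul]
    have h2 : ((a⁻¹ * R * a⁻¹)⁻¹ * B).trace = R.trace := by
      rw [Matrix.mul_inv_rev, Matrix.mul_inv_rev, Matrix.nonsing_inv_nonsing_inv _ hadet,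
        mul_assoc, Matrix.trace_mul_comm, mul_assoc, mul_assoc, ← mul_assoc a, ← hRR,
        ← mul_assoc, Matrix.nonsing_inv_mul _ hRdet, one_mul]
    rw [h1, h2]; ring

/-- Fenchel–Young for the quadratic form of `T`: expand that form at `x - T⁻¹ y`, where it is
nonnegative. -/
theorem two_mul_dotProduct_le {T : Matrix (Fin d) (Fin d) ℝ} (hT : T.PosDef) (x y : Fin d → ℝ) :
    2 * (x ⬝ᵥ y) ≤ x ⬝ᵥ T.mulVec x + y ⬝ᵥ T⁻¹.mulVec y := by
  have hdet : IsUnit T.det := (Matrix.isUnit_iff_isUnit_det T).1 hT.isUnit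
  have h := hT.posSemidef.dotProduct_mulVec_nonneg (x - T⁻¹.mulVec y)
  have e1 : T.mulVec (T⁻¹.mulVec y) = y := by
    rw [Matrix.mulVec_mulVec, Matrix.mul_nonsing_inv _ hdet, Matrix.one_mulVec]
  have e2 : T⁻¹.mulVec y ⬝ᵥ T.mulVec x = y ⬝ᵥ x := by
    have hTt : T.transpose = T := hT.isHermitian
    rw [Matrix.dotProduct_mulVec, ← Matrix.mulVec_transpose, hTt, e1]
  simp only [star_trivial, Matrix.mulVec_sub, sub_dotProduct, dotProduct_sub, e1, e2] at h
  rw [dotProduct_comm y x, dotProduct_comm (T⁻¹.mulVec y) y] at h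
  linarith

end Polar

/-! ### Gelbrich's formula and the critical point. -/

section Gelbrich

variable {d : ℕ}

theorem integrable_mul_eval_multivariateGaussian (m : Vec d) (A : Matrix (Fin d) (Fin d) ℝ)
    (i j : Fin d) :
    Integrable (fun x : Vec d => (x i - m i) * (x j - m j)) (multivariateGaussian m A) := by
  have h : ∀ i : Fin d, MemLp (fun x : Vec d => x i - m i) 2 (multivariateGaussian m A) :=
    fun i => (IsGaussian.memLp_dual (multivariateGaussian m A)
      (EuclideanSpace.proj i : Vec d →L[ℝ] ℝ) 2 (by simp)).sub (memLp_const (m i))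
  exact (h i).integrable_mul (h j)

theorem integral_mul_eval_multivariateGaussian (m : Vec d) {A : Matrix (Fin d) (Fin d) ℝ}
    (hA : A.PosSemidef) (i j : Fin d) :
    ∫ x : Vec d, (x i - m i) * (x j - m j) ∂multivariateGaussian m A = A i j := by
  have hmean : ∀ i : Fin d, ∫ x : Vec d, x i ∂multivariateGaussian m A = m i := fun i => by
    have := (EuclideanSpace.proj i : Vec d →L[ℝ] ℝ).integral_comp_comm
      (IsGaussian.integrable_fun_id (μ := multivariateGaussian m A))
    simpa using this
  rw [← covariance_eval_multivariateGaussian (μ := m) hA i j, covariance]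
  simp only [hmean]

theorem integrable_quadratic_multivariateGaussian (m : Vec d) (A M : Matrix (Fin d) (Fin d) ℝ) :
    Integrable (fun x : Vec d => (x - m).ofLp ⬝ᵥ M.mulVec (x - m).ofLp)
      (multivariateGaussian m A) := by
  simp only [dotProduct, Matrix.mulVec, Finset.mul_sum]
  refine integrable_finsetSum _ fun i _ => integrable_finsetSum _ fun j _ => ?_
  refine ((integrable_mul_eval_multivariateGaussian m A i j).const_mul (M i j)).congr
    (ae_of_all _ fun x => ?_)
  simp only [PiLp.sub_apply]
  ring

theorem integral_quadratic_multivariateGaussian (m : Vec d) {A : Matrix (Fin d) (Fin d) ℝ}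
    (hA : A.PosSemidef) (M : Matrix (Fin d) (Fin d) ℝ) :
    ∫ x : Vec d, (x - m).ofLp ⬝ᵥ M.mulVec (x - m).ofLp ∂multivariateGaussian m A =
      (M * A).trace := by
  have e : (fun x : Vec d => (x - m).ofLp ⬝ᵥ M.mulVec (x - m).ofLp) =
      fun x => ∑ i, ∑ j, M i j * ((x i - m i) * (x j - m j)) := by
    ext x
    simp only [dotProduct, Matrix.mulVec, Finset.mul_sum, WithLp.ofLp_sub, Pi.sub_apply]
    exact Finset.sum_congr rfl fun i _ => Finset.sum_congr rfl fun j _ => by ring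
  have hA' : ∀ i j, A i j = A j i := fun i j => by
    simpa using (hA.isHermitian.apply i j).symm
  rw [e, integral_finsetSum _ fun i _ => integrable_finsetSum _ fun j _ =>
    (integrable_mul_eval_multivariateGaussian m A i j).const_mul (M i j)]
  simp only [Matrix.trace, Matrix.diag, Matrix.mul_apply]
  refine Finset.sum_congr rfl fun i _ => ?_
  rw [integral_finsetSum _ fun j _ =>
    (integrable_mul_eval_multivariateGaussian m A i j).const_mul (M i j)]
  refine Finset.sum_congr rfl fun j _ => ?_
  rw [integral_const_mul, integral_mul_eval_multivariateGaussian m hA, hA' i j]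

theorem ofReal_norm_sq {E : Type*} [NormedAddCommGroup E] (x : E) :
    ENNReal.ofReal (‖x‖ ^ 2) = ‖x‖ₑ ^ (2 : ℝ) := by
  rw [← ofReal_norm, ENNReal.ofReal_rpow_of_nonneg (norm_nonneg _) (by norm_num)]
  norm_num

theorem ofReal_integral_le_lintegral_ofReal {α : Type*} [MeasurableSpace α] {π : Measure α}
    {f : α → ℝ} (hf : Integrable f π) :
    ENNReal.ofReal (∫ x, f x ∂π) ≤ ∫⁻ x, ENNReal.ofReal (f x) ∂π := by
  rw [integral_eq_lintegral_pos_part_sub_lintegral_neg_part hf]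
  exact (ENNReal.ofReal_le_ofReal (sub_le_self _ ENNReal.toReal_nonneg)).trans
    ENNReal.ofReal_toReal_le

theorem norm_sq_eq_dotProduct (x : Vec d) : ‖x‖ ^ 2 = x.ofLp ⬝ᵥ x.ofLp := by
  rw [EuclideanSpace.real_norm_sq_eq]
  simp [dotProduct, pow_two]

theorem integral_dual_sub_multivariateGaussian (m : Vec d) (A : Matrix (Fin d) (Fin d) ℝ)
    (w : Vec d) : ∫ x : Vec d, w.ofLp ⬝ᵥ (x - m).ofLp ∂multivariateGaussian m A = 0 := by
  have h := (innerSL ℝ w).integral_comp_comm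
      (IsGaussian.integrable_fun_id (μ := multivariateGaussian m A))
  have e : ∀ x : Vec d, w.ofLp ⬝ᵥ (x - m).ofLp = innerSL ℝ w x - innerSL ℝ w m := fun x => by
    rw [← map_sub, innerSL_apply_apply, PiLp.inner_apply]
    simp [dotProduct, mul_comm]
  simp only [e]
  rw [integral_sub ((innerSL ℝ w).integrable_comp IsGaussian.integrable_fun_id)
    (integrable_const _), h]
  simp

theorem integrable_dual_sub_multivariateGaussian (m : Vec d) (A : Matrix (Fin d) (Fin d) ℝ)
    (w : Vec d) : Integrable (fun x : Vec d => w.ofLp ⬝ᵥ (x - m).ofLp)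
      (multivariateGaussian m A) := by
  have e : ∀ x : Vec d, w.ofLp ⬝ᵥ (x - m).ofLp = innerSL ℝ w x - innerSL ℝ w m := fun x => by
    rw [← map_sub, innerSL_apply_apply, PiLp.inner_apply]
    simp [dotProduct, mul_comm]
  simp only [e]
  exact ((innerSL ℝ w).integrable_comp IsGaussian.integrable_fun_id).sub (integrable_const _)

/-- Weak duality bound for the transport cost between Gaussian measures. -/
theorem le_lintegral_of_mem_couplings_of_posDef {m ν : Vec d} {A B T : Matrix (Fin d) (Fin d) ℝ}
    (hA : A.PosSemidef) (hB : B.PosSemidef) (hT : T.PosDef) {π : Measure (Vec d × Vec d)}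
    (hπ : π ∈ couplings (multivariateGaussian m A) (multivariateGaussian ν B)) :
    ENNReal.ofReal (‖m - ν‖ ^ 2 + A.trace + B.trace - ((T * A).trace + (T⁻¹ * B).trace)) ≤
      ∫⁻ z, ‖z.1 - z.2‖ₑ ^ (2 : ℝ) ∂π := by
  obtain ⟨hp, h1, h2⟩ := hπ
  -- Kantorovich potentials: expand `‖(m - ν) + x - y‖²` in the centred variables and bound `-2 x·y`
  -- below by Fenchel–Young. The terms linear in `x` and `y` integrate to 0.
  let u : Vec d → ℝ := fun x => (x - m).ofLp ⬝ᵥ (1 - T).mulVec (x - m).ofLp +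
    2 * ((m - ν).ofLp ⬝ᵥ (x - m).ofLp)
  let v : Vec d → ℝ := fun y => (y - ν).ofLp ⬝ᵥ (1 - T⁻¹).mulVec (y - ν).ofLp -
    2 * ((m - ν).ofLp ⬝ᵥ (y - ν).ofLp)
  have hu : Integrable u (multivariateGaussian m A) :=
    (integrable_quadratic_multivariateGaussian m A _).add
      ((integrable_dual_sub_multivariateGaussian m A _).const_mul 2)
  have hv : Integrable v (multivariateGaussian ν B) :=
    (integrable_quadratic_multivariateGaussian ν B _).sub
      ((integrable_dual_sub_multivariateGaussian ν B _).const_mul 2)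
  have hu' : Integrable (fun z => u z.1) π := by
    rw [← h1] at hu; exact hu.comp_measurable measurable_fst
  have hv' : Integrable (fun z => v z.2) π := by
    rw [← h2] at hv; exact hv.comp_measurable measurable_snd
  have iu : ∫ z, u z.1 ∂π = A.trace - (T * A).trace := by
    have : ∫ z, u z.1 ∂π = ∫ x, u x ∂multivariateGaussian m A := by
      rw [← h1, integral_map measurable_fst.aemeasurable (by rw [h1]; exact hu.1)]
    rw [this]
    simp only [u]
    rw [integral_add (integrable_quadratic_multivariateGaussian m A _)
      ((integrable_dual_sub_multivariateGaussian m A _).const_mul 2),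
      integral_quadratic_multivariateGaussian m hA, integral_const_mul,
      integral_dual_sub_multivariateGaussian, sub_mul, one_mul, Matrix.trace_sub]
    ring
  have iv : ∫ z, v z.2 ∂π = B.trace - (T⁻¹ * B).trace := by
    have : ∫ z, v z.2 ∂π = ∫ x, v x ∂multivariateGaussian ν B := by
      rw [← h2, integral_map measurable_snd.aemeasurable (by rw [h2]; exact hv.1)]
    rw [this]
    simp only [v]
    rw [integral_sub (integrable_quadratic_multivariateGaussian ν B _)
      ((integrable_dual_sub_multivariateGaussian ν B _).const_mul 2),
      integral_quadratic_multivariateGaussian ν hB, integral_const_mul,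
      integral_dual_sub_multivariateGaussian, sub_mul, one_mul, Matrix.trace_sub]
    ring
  have hpt : ∀ z : Vec d × Vec d, ‖m - ν‖ ^ 2 + (u z.1 + v z.2) ≤ ‖z.1 - z.2‖ ^ 2 := by
    intro z
    have hkey := two_mul_dotProduct_le hT (z.1 - m).ofLp (z.2 - ν).ofLp
    have e : z.1 - z.2 = (m - ν) + (z.1 - m) - (z.2 - ν) := by abel
    rw [e]
    simp only [u, v]
    generalize z.1 - m = x at *
    generalize z.2 - ν = y at *
    generalize m - ν = w at *
    simp only [norm_sq_eq_dotProduct, WithLp.ofLp_add, WithLp.ofLp_sub, Matrix.sub_mulVec,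
      Matrix.one_mulVec, dotProduct_sub, sub_dotProduct, add_dotProduct, dotProduct_add]
    linarith [dotProduct_comm x.ofLp w.ofLp, dotProduct_comm y.ofLp w.ofLp,
      dotProduct_comm y.ofLp x.ofLp]
  have hint : ∫ z, (‖m - ν‖ ^ 2 + (u z.1 + v z.2)) ∂π =
      ‖m - ν‖ ^ 2 + A.trace + B.trace - ((T * A).trace + (T⁻¹ * B).trace) := by
    have h := integral_add (μ := π) (integrable_const (‖m - ν‖ ^ 2)) (hu'.add hv')
    have h' := integral_add hu' hv'
    simp only [Pi.add_apply] at h h'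
    rw [h, h', iu, iv]
    simp
    ring
  rw [← hint]
  refine (ofReal_integral_le_lintegral_ofReal ((integrable_const _).add (hu'.add hv'))).trans
    (lintegral_mono fun z => ?_)
  rw [← ofReal_norm_sq]
  exact ENNReal.ofReal_le_ofReal (hpt z)

/-- Weak duality is applied to `A` and `B` themselves, with `T` the certificate of the shifted pair.
The discrepancy `(tr T + tr T⁻¹)/(n+1)` is nonnegative and can be dropped, so no bound on `T` is
needed as `n → ∞`. -/
theorem le_lintegral_of_mem_couplings {m ν : Vec d} {A B : Matrix (Fin d) (Fin d) ℝ}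
    (hA : A.PosSemidef) (hB : B.PosSemidef) {π : Measure (Vec d × Vec d)}
    (hπ : π ∈ couplings (multivariateGaussian m A) (multivariateGaussian ν B)) :
    ENNReal.ofReal (‖m - ν‖ ^ 2 + A.trace + B.trace -
      2 * (CFC.sqrt (CFC.sqrt A * B * CFC.sqrt A)).trace) ≤
      ∫⁻ z, ‖z.1 - z.2‖ₑ ^ (2 : ℝ) ∂π := by
  have htr : Tendsto (fun n : ℕ => 2 * (CFC.sqrt (CFC.sqrt (A + (1 / ((n : ℝ) + 1)) • 1) *
      (B + (1 / ((n : ℝ) + 1)) • 1) * CFC.sqrt (A + (1 / ((n : ℝ) + 1)) • 1))).trace) atTop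
      (𝓝 (2 * (CFC.sqrt (CFC.sqrt A * B * CFC.sqrt A)).trace)) :=
    (((continuous_id.matrix_trace).tendsto _).comp (tendsto_sqrt_sqrt_mul_mul_sqrt hA hB)).const_mul 2
  refine le_of_tendsto (ENNReal.tendsto_ofReal (tendsto_const_nhds.sub htr))
    (Eventually.of_forall fun n => ?_)
  obtain ⟨T, hT, hTeq⟩ := exists_dual_certificate (posDef_add_smul_one hA n)
    (posDef_add_smul_one hB n)
  refine le_trans (ENNReal.ofReal_le_ofReal ?_) (le_lintegral_of_mem_couplings_of_posDef hA hB hT hπ)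
  rw [← hTeq]
  have hn : (0 : ℝ) ≤ 1 / ((n : ℝ) + 1) := by positivity
  have h1 := mul_nonneg hn hT.posSemidef.trace_nonneg
  have h2 := mul_nonneg hn hT.inv.posSemidef.trace_nonneg
  simp only [mul_add, Matrix.mul_smul, mul_one, Matrix.trace_add, Matrix.trace_smul, smul_eq_mul]
  linarith

theorem map_toEuclideanCLM_stdGaussian {U : Matrix (Fin d) (Fin d) ℝ}
    (hU : U.conjTranspose * U = 1) :
    (stdGaussian (Vec d)).map (Matrix.toEuclideanCLM (𝕜 := ℝ) U) = stdGaussian (Vec d) := by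
  let L : Vec d →ₗᵢ[ℝ] Vec d :=
    { toLinearMap := (Matrix.toEuclideanCLM (𝕜 := ℝ) U : Vec d →L[ℝ] Vec d).toLinearMap
      norm_map' := fun x => by
        rw [← sq_eq_sq₀ (norm_nonneg _) (norm_nonneg _)]
        simp only [norm_sq_eq_dotProduct, ContinuousLinearMap.coe_coe, Matrix.ofLp_toEuclideanCLM]
        rw [Matrix.dotProduct_mulVec, Matrix.vecMul_mulVec]
        have hU' : U.transpose * U = 1 := hU
        rw [hU', Matrix.vecMul_one] }
  exact stdGaussian_map (L.toLinearIsometryEquiv rfl)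

/-- The optimal coupling of two Gaussian measures. -/
theorem exists_mem_couplings_lintegral_eq (m ν : Vec d) {A B : Matrix (Fin d) (Fin d) ℝ}
    (hA : A.PosSemidef) (hB : B.PosSemidef) :
    0 ≤ ‖m - ν‖ ^ 2 + A.trace + B.trace -
      2 * (CFC.sqrt (CFC.sqrt A * B * CFC.sqrt A)).trace ∧
    ∃ π ∈ couplings (multivariateGaussian m A) (multivariateGaussian ν B),
      ∫⁻ z, ‖z.1 - z.2‖ₑ ^ (2 : ℝ) ∂π = ENNReal.ofReal (‖m - ν‖ ^ 2 + A.trace + B.trace -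
        2 * (CFC.sqrt (CFC.sqrt A * B * CFC.sqrt A)).trace) := by
  obtain ⟨U, hU, hpol⟩ := exists_polar hA hB
  set R := CFC.sqrt (CFC.sqrt A * B * CFC.sqrt A) with hR
  -- Both coordinates use the same noise `z`; rotating it by `U` preserves the second marginal and,
  -- by the polar decomposition, makes the cross term `tr (Uᵗ B^{1/2} A^{1/2})` equal to `tr R`.
  let f : Vec d → Vec d := fun z => m + Matrix.toEuclideanCLM (𝕜 := ℝ) (CFC.sqrt A) z
  let g : Vec d → Vec d := fun z => ν + Matrix.toEuclideanCLM (𝕜 := ℝ) (CFC.sqrt B)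
    (Matrix.toEuclideanCLM (𝕜 := ℝ) U z)
  have hf : Measurable f := by fun_prop
  have hg : Measurable g := by fun_prop
  set W := CFC.sqrt A - CFC.sqrt B * U with hW
  -- The form `z - 0` matches the moment lemmas for mean 0 and covariance 1.
  have hfg : ∀ z, ‖f z - g z‖ ^ 2 = ‖m - ν‖ ^ 2 +
      (2 * ((W.transpose.mulVec (m - ν).ofLp) ⬝ᵥ (z - 0).ofLp) +
        (z - 0).ofLp ⬝ᵥ (W.transpose * W).mulVec (z - 0).ofLp) := by
    intro z
    have e : f z - g z = (m - ν) + Matrix.toEuclideanCLM (𝕜 := ℝ) W z := by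
      simp only [f, g, hW, map_sub, map_mul, sub_apply,
        mul_apply_eq_comp]
      abel
    rw [e, sub_zero]
    simp only [norm_sq_eq_dotProduct, WithLp.ofLp_add, Matrix.ofLp_toEuclideanCLM,
      add_dotProduct, dotProduct_add]
    have h1 : W.mulVec z.ofLp ⬝ᵥ W.mulVec z.ofLp =
        z.ofLp ⬝ᵥ (W.transpose * W).mulVec z.ofLp := by
      rw [Matrix.dotProduct_mulVec, Matrix.vecMul_mulVec, ← Matrix.dotProduct_mulVec,
        dotProduct_comm]
    have h2 : W.transpose.mulVec (m - ν).ofLp ⬝ᵥ z.ofLp = (m - ν).ofLp ⬝ᵥ W.mulVec z.ofLp := by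
      rw [Matrix.mulVec_transpose, Matrix.dotProduct_mulVec]
    rw [h1, h2, dotProduct_comm (W.mulVec z.ofLp)]
    ring
  have htr : (W.transpose * W).trace = A.trace + B.trace - 2 * R.trace := by
    have ha : (CFC.sqrt A).transpose = CFC.sqrt A := coe_sqrt_conjTranspose A
    have hb : (CFC.sqrt B).transpose = CFC.sqrt B := coe_sqrt_conjTranspose B
    have hU' : U.transpose * U = 1 := hU
    have hUU : U * U.transpose = 1 := mul_eq_one_comm.1 hU'
    have haa : CFC.sqrt A * CFC.sqrt A = A := CFC.sqrt_mul_sqrt_self _ hA.nonneg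
    have hbb : CFC.sqrt B * CFC.sqrt B = B := CFC.sqrt_mul_sqrt_self _ hB.nonneg
    have hc : (U.transpose * CFC.sqrt B * CFC.sqrt A).trace = R.trace := by
      rw [mul_assoc, hpol, ← mul_assoc, hU', one_mul]
    have hc' : (CFC.sqrt A * (CFC.sqrt B * U)).trace = R.trace := by
      rw [← hc, ← Matrix.trace_transpose]
      simp only [Matrix.transpose_mul, ha, hb]
    have hd : (U.transpose * CFC.sqrt B * (CFC.sqrt B * U)).trace = B.trace := by
      rw [mul_assoc, ← mul_assoc (CFC.sqrt B), hbb, Matrix.trace_mul_comm, mul_assoc, hUU, mul_one]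
    rw [hW, Matrix.transpose_sub, Matrix.transpose_mul, ha, hb, sub_mul, mul_sub, mul_sub, haa]
    simp only [Matrix.trace_sub, hc, hc', hd]
    ring
  have hI1 := integrable_dual_sub_multivariateGaussian (0 : Vec d) 1
    (WithLp.toLp 2 (W.transpose.mulVec (m - ν).ofLp))
  have hI2 := integrable_quadratic_multivariateGaussian (0 : Vec d) 1 (W.transpose * W)
  have hI3 := integral_dual_sub_multivariateGaussian (0 : Vec d) 1
    (WithLp.toLp 2 (W.transpose.mulVec (m - ν).ofLp))
  have hI4 := integral_quadratic_multivariateGaussian (0 : Vec d) Matrix.PosSemidef.one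
    (W.transpose * W)
  rw [multivariateGaussian_zero_one] at hI1 hI2 hI3 hI4
  have hint : Integrable (fun z => ‖f z - g z‖ ^ 2) (stdGaussian (Vec d)) := by
    simp only [hfg]
    exact (integrable_const _).add ((hI1.const_mul 2).add hI2)
  have hval : ∫ z, ‖f z - g z‖ ^ 2 ∂stdGaussian (Vec d) = ‖m - ν‖ ^ 2 + A.trace + B.trace -
      2 * R.trace := by
    simp only [hfg]
    have h := integral_add (μ := stdGaussian (Vec d)) (integrable_const (‖m - ν‖ ^ 2))
      ((hI1.const_mul 2).add hI2)
    have h' := integral_add (hI1.const_mul 2) hI2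
    simp only [Pi.add_apply] at h h'
    rw [h, h', integral_const_mul, hI3, hI4, mul_one, htr]
    simp
    ring
  refine ⟨hval ▸ integral_nonneg fun z => by positivity,
    (stdGaussian (Vec d)).map (fun z => (f z, g z)),
    ⟨Measure.isProbabilityMeasure_map (hf.prodMk hg).aemeasurable, ?_, ?_⟩, ?_⟩
  · rw [Measure.map_map measurable_fst (hf.prodMk hg)]
    rfl
  · rw [Measure.map_map measurable_snd (hf.prodMk hg), multivariateGaussian]
    conv_rhs => rw [← map_toEuclideanCLM_stdGaussian hU]
    rw [Measure.map_map (by fun_prop) (by fun_prop)]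
    rfl
  · rw [lintegral_map (by fun_prop) (hf.prodMk hg), ← hval,
      ofReal_integral_eq_lintegral_ofReal hint (ae_of_all _ fun z => by positivity)]
    simp only [ofReal_norm_sq]

/-- Gelbrich's formula for the Wasserstein distance of Gaussian measures. -/
theorem wassersteinTwoSq_multivariateGaussian (m ν : Vec d) {A B : SymMat d}
    (hA : (A : Matrix (Fin d) (Fin d) ℝ).PosSemidef)
    (hB : (B : Matrix (Fin d) (Fin d) ℝ).PosSemidef) :
    wassersteinTwoSq (multivariateGaussian m (A : Matrix (Fin d) (Fin d) ℝ))
      (multivariateGaussian ν (B : Matrix (Fin d) (Fin d) ℝ)) = Φ d (m, ν, A, B) := by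
  obtain ⟨h0, π, hπ, hval⟩ := exists_mem_couplings_lintegral_eq m ν hA hB
  have hW : wasserstein 2 (multivariateGaussian m (A : Matrix (Fin d) (Fin d) ℝ))
      (multivariateGaussian ν (B : Matrix (Fin d) (Fin d) ℝ)) =
      ENNReal.ofReal (Φ d (m, ν, A, B)) ^ (1 / 2 : ℝ) := by
    refine le_antisymm ((iInf₂_le π hπ).trans (by rw [hval]; rfl)) (le_iInf₂ fun π' hπ' => ?_)
    exact ENNReal.rpow_le_rpow (le_lintegral_of_mem_couplings hA hB hπ') (by norm_num)
  have h0' : 0 ≤ Φ d (m, ν, A, B) := h0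
  rw [wassersteinTwoSq, hW, ← ENNReal.toReal_rpow, ENNReal.toReal_ofReal h0', ← Real.sqrt_eq_rpow]
  exact Real.sq_sqrt h0'

theorem Φ_nonneg (m ν : Vec d) {A B : SymMat d}
    (hA : (A : Matrix (Fin d) (Fin d) ℝ).PosSemidef)
    (hB : (B : Matrix (Fin d) (Fin d) ℝ).PosSemidef) : 0 ≤ Φ d (m, ν, A, B) :=
  (exists_mem_couplings_lintegral_eq m ν hA hB).1

theorem Φ_self (m ν : Vec d) {A : SymMat d} (hA : (A : Matrix (Fin d) (Fin d) ℝ).PosSemidef) :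
    Φ d (m, ν, A, A) = ‖m - ν‖ ^ 2 := by
  have haa : CFC.sqrt (A : Matrix (Fin d) (Fin d) ℝ) * CFC.sqrt (A : Matrix (Fin d) (Fin d) ℝ) = A :=
    CFC.sqrt_mul_sqrt_self _ hA.nonneg
  have h : CFC.sqrt (A : Matrix (Fin d) (Fin d) ℝ) * A * CFC.sqrt (A : Matrix (Fin d) (Fin d) ℝ) =
      A * A := by
    generalize CFC.sqrt (A : Matrix (Fin d) (Fin d) ℝ) = a at haa
    rw [← haa]
    simp only [mul_assoc]
  rw [Φ, h, CFC.sqrt_mul_self _ hA.nonneg]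
  ring

/-- No derivative is computed: `Φ` is nonnegative near this point and zero at it. -/
theorem fderiv_Φ_self (m : Vec d) {A : SymMat d} (hA : (A : Matrix (Fin d) (Fin d) ℝ).PosDef) :
    fderiv ℝ (Φ d) (m, m, A, A) = 0 := by
  refine IsLocalMin.fderiv_eq_zero ?_
  have h1 : ∀ᶠ θ : Vec d × Vec d × SymMat d × SymMat d in 𝓝 (m, m, A, A),
      (θ.2.2.1 : Matrix (Fin d) (Fin d) ℝ).PosDef :=
    (isOpen_posDef.preimage continuous_snd.snd.fst).mem_nhds hA
  have h2 : ∀ᶠ θ : Vec d × Vec d × SymMat d × SymMat d in 𝓝 (m, m, A, A),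
      (θ.2.2.2 : Matrix (Fin d) (Fin d) ℝ).PosDef :=
    (isOpen_posDef.preimage continuous_snd.snd.snd).mem_nhds hA
  filter_upwards [h1, h2] with θ hθ1 hθ2
  rw [Φ_self m m hA.posSemidef, sub_self, norm_zero]
  simpa using Φ_nonneg θ.1 θ.2.1 hθ1.posSemidef hθ2.posSemidef

end Gelbrich

/-! ### Moments of the standard normal law. -/

section Moments

theorem iteratedDeriv_mgf_standardGaussian (n : ℕ) :
    iteratedDeriv n (mgf (fun x => x) (gaussianReal 0 1)) 0 = ∫ x, x ^ n ∂gaussianReal 0 1 := by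
  rw [iteratedDeriv_mgf_zero] <;> simp

/-- The recursion `p ↦ p' + t p` produces the successive derivatives of the moment generating
function `exp (t²/2)`, whose values at 0 are the moments. -/
theorem deriv_mul_exp_half_sq {p p' : ℝ → ℝ} (h : ∀ t, HasDerivAt p (p' t) t) :
    deriv (fun t => p t * Real.exp (t ^ 2 / 2)) =
      fun t => (p' t + t * p t) * Real.exp (t ^ 2 / 2) := by
  ext t
  have h1 : HasDerivAt (fun t : ℝ => t ^ 2 / 2) t t := by
    have := (hasDerivAt_pow 2 t).div_const 2
    simpa using this
  rw [((h t).fun_mul h1.exp).deriv]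
  ring

theorem iteratedDeriv_mgf_standardGaussian_eq :
    iteratedDeriv 1 (mgf (fun x => x) (gaussianReal 0 1)) =
      (fun t => t * Real.exp (t ^ 2 / 2)) ∧
    iteratedDeriv 2 (mgf (fun x => x) (gaussianReal 0 1)) =
      (fun t => (1 + t ^ 2) * Real.exp (t ^ 2 / 2)) ∧
    iteratedDeriv 3 (mgf (fun x => x) (gaussianReal 0 1)) =
      (fun t => (3 * t + t ^ 3) * Real.exp (t ^ 2 / 2)) ∧
    iteratedDeriv 4 (mgf (fun x => x) (gaussianReal 0 1)) =
      (fun t => (3 + 6 * t ^ 2 + t ^ 4) * Real.exp (t ^ 2 / 2)) := by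
  have h0 : mgf (fun x => x) (gaussianReal 0 1) = fun t => 1 * Real.exp (t ^ 2 / 2) := by
    rw [mgf_fun_id_gaussianReal]; simp
  have h1 : iteratedDeriv 1 (mgf (fun x => x) (gaussianReal 0 1)) =
      (fun t => t * Real.exp (t ^ 2 / 2)) := by
    rw [iteratedDeriv_one, h0, deriv_mul_exp_half_sq fun t => hasDerivAt_const t 1]
    simp
  have h2 : iteratedDeriv 2 (mgf (fun x => x) (gaussianReal 0 1)) =
      (fun t => (1 + t ^ 2) * Real.exp (t ^ 2 / 2)) := by
    rw [iteratedDeriv_succ, h1, deriv_mul_exp_half_sq hasDerivAt_id']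
    ext t; simp; ring
  have h3 : iteratedDeriv 3 (mgf (fun x => x) (gaussianReal 0 1)) =
      (fun t => (3 * t + t ^ 3) * Real.exp (t ^ 2 / 2)) := by
    rw [iteratedDeriv_succ, h2,
      deriv_mul_exp_half_sq fun t => ((hasDerivAt_pow 2 t).const_add 1)]
    ext t; simp; ring
  have h4 : iteratedDeriv 4 (mgf (fun x => x) (gaussianReal 0 1)) =
      (fun t => (3 + 6 * t ^ 2 + t ^ 4) * Real.exp (t ^ 2 / 2)) := by
    rw [iteratedDeriv_succ, h3,
      deriv_mul_exp_half_sq fun t =>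
        (((hasDerivAt_id' t).const_mul 3).fun_add (hasDerivAt_pow 3 t))]
    ext t; simp; ring
  exact ⟨h1, h2, h3, h4⟩

theorem integral_pow_standardGaussian :
    ∫ x, x ∂gaussianReal 0 1 = 0 ∧ ∫ x, x ^ 2 ∂gaussianReal 0 1 = 1 ∧
    ∫ x, x ^ 3 ∂gaussianReal 0 1 = 0 ∧ ∫ x, x ^ 4 ∂gaussianReal 0 1 = 3 := by
  obtain ⟨h1, h2, h3, h4⟩ := iteratedDeriv_mgf_standardGaussian_eq
  refine ⟨integral_id_gaussianReal, ?_, ?_, ?_⟩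
  · rw [← iteratedDeriv_mgf_standardGaussian, h2]; simp
  · rw [← iteratedDeriv_mgf_standardGaussian, h3]; simp
  · rw [← iteratedDeriv_mgf_standardGaussian, h4]; simp

theorem integrable_pow_standardGaussian (n : ℕ) :
    Integrable (fun x : ℝ => x ^ n) (gaussianReal 0 1) := by
  have h := (memLp_id_gaussianReal' (μ := 0) (v := 1) n (by simp)).integrable_norm_pow'
  refine (integrable_norm_iff (by fun_prop)).1 ?_
  simpa [norm_pow] using h

/-- The Hermite polynomials of degree at most two. -/
def hermiteLow : ℕ → ℝ → ℝ
  | 0, _ => 1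
  | 1, x => x
  | 2, x => x ^ 2 - 1
  | _, _ => 0

theorem measurable_hermiteLow (a : ℕ) : Measurable (hermiteLow a) := by
  match a with
  | 0 => exact measurable_const
  | 1 => exact measurable_id
  | 2 => exact (measurable_id.pow_const 2).sub_const 1
  | _ + 3 => exact measurable_const

theorem hermiteLow_orthogonal {a b : ℕ} (ha : a ≤ 2) (hb : b ≤ 2) :
    Integrable (fun x => hermiteLow a x * hermiteLow b x) (gaussianReal 0 1) ∧
    ∫ x, hermiteLow a x * hermiteLow b x ∂gaussianReal 0 1 =
      if a = b then (a.factorial : ℝ) else 0 := by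
  obtain ⟨h1, h2, h3, h4⟩ := integral_pow_standardGaussian
  have i1 : Integrable (fun x : ℝ => x) (gaussianReal 0 1) := by
    simpa using integrable_pow_standardGaussian 1
  have i2 := integrable_pow_standardGaussian 2
  have i3 := integrable_pow_standardGaussian 3
  have i4 := integrable_pow_standardGaussian 4
  have ic : Integrable (fun _ : ℝ => (1 : ℝ)) (gaussianReal 0 1) := integrable_const 1
  have p12 : (fun x : ℝ => x * (x ^ 2 - 1)) = fun x => x ^ 3 - x := by ext x; ring
  have p21 : (fun x : ℝ => (x ^ 2 - 1) * x) = fun x => x ^ 3 - x := by ext x; ring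
  have p22 : (fun x : ℝ => (x ^ 2 - 1) * (x ^ 2 - 1)) = fun x => x ^ 4 - 2 * x ^ 2 + 1 := by
    ext x; ring
  have p11 : (fun x : ℝ => x * x) = fun x => x ^ 2 := by ext x; ring
  have i20 : Integrable (fun x : ℝ => x ^ 2 - 1) (gaussianReal 0 1) := i2.sub ic
  have i31 : Integrable (fun x : ℝ => x ^ 3 - x) (gaussianReal 0 1) := i3.sub i1
  have i42 : Integrable (fun x : ℝ => x ^ 4 - 2 * x ^ 2) (gaussianReal 0 1) :=
    i4.sub (i2.const_mul 2)
  have i420 : Integrable (fun x : ℝ => x ^ 4 - 2 * x ^ 2 + 1) (gaussianReal 0 1) := i42.add ic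
  have e02 : ∫ x : ℝ, (x ^ 2 - 1) ∂gaussianReal 0 1 = 0 := by
    rw [integral_sub i2 ic, h2]; simp
  have e12 : ∫ x : ℝ, (x ^ 3 - x) ∂gaussianReal 0 1 = 0 := by
    rw [integral_sub i3 i1, h3, h1]; simp
  have e22 : ∫ x : ℝ, (x ^ 4 - 2 * x ^ 2 + 1) ∂gaussianReal 0 1 = 2 := by
    rw [integral_add i42 ic, integral_sub i4 (i2.const_mul 2), integral_const_mul, h4, h2]
    simp; norm_num
  interval_cases a <;> interval_cases b <;>
    simp only [hermiteLow, p12, p21, p22, p11, e02, e12, e22, h1, h2, i1, i2, i20, i31, i420, ic,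
      one_mul, mul_one] <;> simp

end Moments

/-! ### Hermite products and their orthogonality. -/

section Hermite

variable {d : ℕ}

/-- Products of Hermite polynomials of degree at most two. -/
def hermiteProd (c : Fin d → ℕ) (z : Fin d → ℝ) : ℝ := ∏ m, hermiteLow (c m) (z m)

theorem measurable_hermiteProd (c : Fin d → ℕ) : Measurable (hermiteProd c) :=
  Finset.measurable_prod _ fun m _ => (measurable_hermiteLow _).comp (measurable_pi_apply m)

theorem integrable_hermiteProd_mul {c c' : Fin d → ℕ} (hc : ∀ m, c m ≤ 2) (hc' : ∀ m, c' m ≤ 2) :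
    Integrable (fun z => hermiteProd c z * hermiteProd c' z)
      (Measure.pi fun _ : Fin d => gaussianReal 0 1) := by
  simp only [hermiteProd, ← Finset.prod_mul_distrib]
  exact Integrable.fintype_prod fun m => (hermiteLow_orthogonal (hc m) (hc' m)).1

theorem integral_hermiteProd_mul {c c' : Fin d → ℕ} (hc : ∀ m, c m ≤ 2) (hc' : ∀ m, c' m ≤ 2) :
    ∫ z, hermiteProd c z * hermiteProd c' z ∂(Measure.pi fun _ : Fin d => gaussianReal 0 1) =
      if c = c' then ∏ m, ((c m).factorial : ℝ) else 0 := by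
  simp only [hermiteProd, ← Finset.prod_mul_distrib]
  rw [integral_fintype_prod_eq_prod (fun m x => hermiteLow (c m) x * hermiteLow (c' m) x)]
  simp only [fun m => (hermiteLow_orthogonal (hc m) (hc' m)).2]
  split_ifs with h
  · simp [h]
  · obtain ⟨m, hm⟩ := Function.ne_iff.1 h
    exact Finset.prod_eq_zero (Finset.mem_univ m) (if_neg hm)

theorem memLp_hermiteProd {c : Fin d → ℕ} (hc : ∀ m, c m ≤ 2) :
    MemLp (hermiteProd c) 2 (Measure.pi fun _ : Fin d => gaussianReal 0 1) := by
  rw [memLp_two_iff_integrable_sq (measurable_hermiteProd c).aestronglyMeasurable]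
  simpa only [pow_two] using integrable_hermiteProd_mul hc hc

theorem integral_hermiteProd {c : Fin d → ℕ} (hc : ∀ m, c m ≤ 2) (h0 : c ≠ 0) :
    ∫ z, hermiteProd c z ∂(Measure.pi fun _ : Fin d => gaussianReal 0 1) = 0 := by
  have := integral_hermiteProd_mul hc (c' := 0) (by simp)
  rw [if_neg h0] at this
  simpa [hermiteProd, hermiteLow] using this

/-- Coordinates of the pair (mean, covariance). -/
abbrev MeanCovIdx (d : ℕ) : Type := Fin d ⊕ UpperIdx d

/-- The multi-index of the Hermite polynomial attached to a coordinate. -/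
def multiIdx : MeanCovIdx d → Fin d → ℕ
  | .inl i => Pi.single i 1
  | .inr p => Pi.single p.1.1 1 + Pi.single p.1.2 1

/-- The limiting variance of a coordinate. -/
def coordVar : MeanCovIdx d → NNReal
  | .inl _ => 1
  | .inr p => if p.1.1 = p.1.2 then 2 else 1

theorem multiIdx_le_two (k : MeanCovIdx d) (m : Fin d) : multiIdx k m ≤ 2 := by
  rcases k with i | p
  · simp only [multiIdx, Pi.single_apply]; split_ifs <;> norm_num
  · simp only [multiIdx, Pi.add_apply, Pi.single_apply]; split_ifs <;> norm_num

theorem sum_multiIdx (k : MeanCovIdx d) :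
    ∑ m, multiIdx k m = Sum.elim (fun _ => 1) (fun _ => 2) k := by
  rcases k with i | p <;> simp [multiIdx, Finset.sum_add_distrib]

theorem multiIdx_ne_zero (k : MeanCovIdx d) : multiIdx k ≠ 0 := by
  intro h
  have := sum_multiIdx k
  rw [h] at this
  rcases k with i | p <;> simp at this

/-- The total degree separates mean from covariance coordinates, and `i ≤ j` makes a pair
recoverable from its multiset. Distinct coordinates thus have orthogonal Hermite products. -/
theorem multiIdx_injective : Function.Injective (multiIdx (d := d)) := by
  intro k l h
  have hs := sum_multiIdx k
  rw [h, sum_multiIdx] at hs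
  rcases k with i | ⟨⟨i, j⟩, hij⟩ <;> rcases l with i' | ⟨⟨i', j'⟩, hij'⟩ <;> simp at hs
  · have := congrFun h i
    simp only [multiIdx, Pi.single_apply] at this
    by_contra hne
    simp_all
  · simp only at hij hij'
    have hi := congrFun h i
    have hj := congrFun h j
    have hi' := congrFun h i'
    have hj' := congrFun h j'
    simp only [multiIdx, Pi.add_apply, Pi.single_apply] at hi hj hi' hj'
    have : i = i' ∧ j = j' := by
      constructor <;> grind
    simp [this]

/-- The squared norm of a Hermite product is a product of factorials; `2! = 2` on the diagonal is
the variance 2 of the diagonal entries of `H`. -/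
theorem prod_factorial_multiIdx (k : MeanCovIdx d) :
    ∏ m, ((multiIdx k m).factorial : ℝ) = coordVar k := by
  rcases k with i | ⟨⟨i, j⟩, hij⟩
  · rw [Finset.prod_eq_single i]
    · simp [multiIdx, coordVar]
    · intro m _ hm; simp [multiIdx, hm]
    · simp
  · by_cases h : i = j
    · subst h
      rw [Finset.prod_eq_single i]
      · simp [multiIdx, coordVar]
      · intro m _ hm; simp [multiIdx, hm]
      · simp
    · rw [Finset.prod_eq_one]
      · simp [coordVar, h]
      · intro m _
        have : multiIdx (.inr ⟨(i, j), hij⟩ : MeanCovIdx d) m ≤ 1 := by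
          simp only [multiIdx, Pi.add_apply, Pi.single_apply]
          split_ifs <;> simp_all
        interval_cases multiIdx (.inr ⟨(i, j), hij⟩ : MeanCovIdx d) m <;> simp

theorem hermiteProd_inl (i : Fin d) (z : Fin d → ℝ) :
    hermiteProd (multiIdx (.inl i)) z = z i := by
  rw [hermiteProd, Finset.prod_eq_single i]
  · simp [multiIdx, hermiteLow]
  · intro m _ hm; simp [multiIdx, hm, hermiteLow]
  · simp

theorem hermiteProd_inr (p : UpperIdx d) (z : Fin d → ℝ) :
    hermiteProd (multiIdx (.inr p)) z = z p.1.1 * z p.1.2 - if p.1.1 = p.1.2 then 1 else 0 := by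
  obtain ⟨⟨i, j⟩, hij⟩ := p
  by_cases h : i = j
  · subst h
    rw [hermiteProd, Finset.prod_eq_single i]
    · simp [multiIdx, hermiteLow]; ring
    · intro m _ hm; simp [multiIdx, hm, hermiteLow]
    · simp
  · rw [hermiteProd, Finset.prod_eq_mul i j h]
    · simp [multiIdx, hermiteLow, h, Ne.symm h]
    · intro m _ hm; simp [multiIdx, hm.1, hm.2, hermiteLow]
    · simp
    · simp

theorem memLp_sum_hermiteProd (a : MeanCovIdx d → ℝ) :
    MemLp (fun z => ∑ k, a k * hermiteProd (multiIdx k) z) 2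
      (Measure.pi fun _ : Fin d => gaussianReal 0 1) :=
  memLp_finsetSum _ fun k _ => (memLp_hermiteProd (multiIdx_le_two k)).const_mul (a k)

theorem integral_sum_hermiteProd (a : MeanCovIdx d → ℝ) :
    ∫ z, ∑ k, a k * hermiteProd (multiIdx k) z ∂(Measure.pi fun _ : Fin d => gaussianReal 0 1)
      = 0 := by
  rw [integral_finsetSum _ fun k _ =>
    ((memLp_hermiteProd (multiIdx_le_two k)).integrable (by norm_num)).const_mul (a k)]
  simp only [integral_const_mul, integral_hermiteProd (multiIdx_le_two _) (multiIdx_ne_zero _),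
    mul_zero, Finset.sum_const_zero]

/-- By orthogonality only diagonal terms survive, as for independent Gaussians with variances
`coordVar k`. -/
theorem variance_sum_hermiteProd (a : MeanCovIdx d → ℝ) :
    Var[fun z => ∑ k, a k * hermiteProd (multiIdx k) z;
      Measure.pi fun _ : Fin d => gaussianReal 0 1] = ∑ k, a k ^ 2 * coordVar k := by
  have hint : ∀ k l, Integrable (fun z => (a k * a l) *
      (hermiteProd (multiIdx k) z * hermiteProd (multiIdx l) z))
      (Measure.pi fun _ : Fin d => gaussianReal 0 1) := fun k l =>
    (integrable_hermiteProd_mul (multiIdx_le_two k) (multiIdx_le_two l)).const_mul _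
  rw [variance_of_integral_eq_zero (memLp_sum_hermiteProd a).1.aemeasurable
    (integral_sum_hermiteProd a)]
  have e : ∀ z, (∑ k, a k * hermiteProd (multiIdx k) z) ^ 2 =
      ∑ k, ∑ l, (a k * a l) * (hermiteProd (multiIdx k) z * hermiteProd (multiIdx l) z) := by
    intro z
    rw [pow_two, Finset.sum_mul_sum]
    exact Finset.sum_congr rfl fun k _ => Finset.sum_congr rfl fun l _ => by ring
  simp only [e]
  rw [integral_finsetSum _ fun k _ => integrable_finsetSum _ fun l _ => hint k l]
  refine Finset.sum_congr rfl fun k _ => ?_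
  rw [integral_finsetSum _ fun l _ => hint k l]
  simp only [integral_const_mul,
    integral_hermiteProd_mul (multiIdx_le_two _) (multiIdx_le_two _), multiIdx_injective.eq_iff,
    prod_factorial_multiIdx]
  simp [pow_two]

/-- Linear combinations of independent centered Gaussian variables are Gaussian. -/
theorem map_sum_mul_pi_gaussianReal {ι : Type*} [Fintype ι] (v : ι → NNReal) (a : ι → ℝ) :
    (Measure.pi fun k => gaussianReal 0 (v k)).map (fun y => ∑ k, a k * y k) =
      gaussianReal 0 (∑ k, a k ^ 2 * (v k : ℝ)).toNNReal := by
  have hm : Measurable fun y : ι → ℝ => ∑ k, a k * y k := by fun_prop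
  have : IsProbabilityMeasure ((Measure.pi fun k => gaussianReal 0 (v k)).map
    (fun y => ∑ k, a k * y k)) := Measure.isProbabilityMeasure_map hm.aemeasurable
  refine Measure.ext_of_charFun ?_
  ext t
  rw [charFun_apply_real, integral_map hm.aemeasurable (by fun_prop), charFun_gaussianReal]
  have e : ∀ y : ι → ℝ, Complex.exp (t * ((∑ k, a k * y k : ℝ) : ℂ) * Complex.I) =
      ∏ k, Complex.exp (((t * a k : ℝ) : ℂ) * (y k : ℂ) * Complex.I) := by
    intro y
    rw [← Complex.exp_sum]
    congr 1
    push_cast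
    rw [Finset.mul_sum, Finset.sum_mul]
    exact Finset.sum_congr rfl fun k _ => by ring
  simp only [e]
  rw [integral_fintype_prod_eq_prod
    (fun k (x : ℝ) => Complex.exp (((t * a k : ℝ) : ℂ) * (x : ℂ) * Complex.I))]
  simp only [← charFun_apply_real, charFun_gaussianReal]
  rw [← Complex.exp_sum]
  congr 1
  have h0 : 0 ≤ ∑ k, a k ^ 2 * (v k : ℝ) := Finset.sum_nonneg fun k _ => by positivity
  have h1 : ((((∑ k, a k ^ 2 * (v k : ℝ)).toNNReal : NNReal) : ℝ) : ℂ) =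
      ∑ k, (a k : ℂ) ^ 2 * ((v k : ℝ) : ℂ) := by
    rw [Real.coe_toNNReal _ h0]; push_cast; rfl
  rw [h1]
  simp only [Complex.ofReal_zero, mul_zero, zero_mul, zero_sub, Finset.sum_neg_distrib,
    Finset.sum_mul, Finset.sum_div]
  congr 1
  exact Finset.sum_congr rfl fun k _ => by push_cast; ring

end Hermite

/-! ### Limit law and influence function in common coordinates. -/

section Coordinates

variable {d : ℕ}

/-- The symmetric matrix `x xᵗ`. -/
noncomputable def outerSym (x : Vec d) : SymMat d :=
  ⟨Matrix.vecMulVec x.ofLp x.ofLp, by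
    show IsSelfAdjoint _
    rw [IsSelfAdjoint, Matrix.star_eq_conjTranspose, Matrix.conjTranspose_vecMulVec]
    simp⟩

theorem coe_outerSym (x : Vec d) :
    (outerSym x : Matrix (Fin d) (Fin d) ℝ) = Matrix.vecMulVec x.ofLp x.ofLp := rfl

theorem continuous_outerSym : Continuous (outerSym (d := d)) := by
  refine Continuous.subtype_mk (continuous_matrix fun i j => ?_) _
  simp only [Matrix.vecMulVec_apply]
  fun_prop

/-- A linear combination of coordinates, as a pair of a vector and a symmetric matrix. -/
noncomputable def meanCovMap (S : Matrix (Fin d) (Fin d) ℝ) :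
    (MeanCovIdx d → ℝ) →ₗ[ℝ] Vec d × SymMat d where
  toFun y := (Matrix.toEuclideanCLM (𝕜 := ℝ) (CFC.sqrt S) (WithLp.toLp 2 fun i => y (.inl i)),
    conjSqrt S (symOfUpper fun p => y (.inr p)))
  map_add' y z := by
    refine Prod.ext ?_ (Subtype.ext ?_)
    · rw [Prod.fst_add, ← map_add]; rfl
    · show CFC.sqrt S * _ * CFC.sqrt S = CFC.sqrt S * _ * CFC.sqrt S + CFC.sqrt S * _ * CFC.sqrt S
      rw [← add_mul, ← mul_add]; rfl
  map_smul' c y := by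
    refine Prod.ext ?_ (Subtype.ext ?_)
    · rw [Prod.smul_fst, RingHom.id_apply, ← map_smul]; rfl
    · show CFC.sqrt S * _ * CFC.sqrt S = c • (CFC.sqrt S * _ * CFC.sqrt S)
      rw [← smul_mul_assoc, ← mul_smul_comm]; rfl

theorem meanCovMap_apply (S : Matrix (Fin d) (Fin d) ℝ) (y : MeanCovIdx d → ℝ) :
    meanCovMap S y =
      (Matrix.toEuclideanCLM (𝕜 := ℝ) (CFC.sqrt S) (WithLp.toLp 2 fun i => y (.inl i)),
        conjSqrt S (symOfUpper fun p => y (.inr p))) := rfl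

theorem measurable_meanCovMap (S : Matrix (Fin d) (Fin d) ℝ) : Measurable (meanCovMap S) :=
  (meanCovMap S).continuous_of_finiteDimensional.measurable

/-- A linear image of one product of Gaussians: scalar projections are then Gaussian, and full
support can be pushed forward. -/
theorem meanCovLimit_eq_map (S : Matrix (Fin d) (Fin d) ℝ) :
    meanCovLimit S =
      (Measure.pi fun k : MeanCovIdx d => gaussianReal 0 (coordVar k)).map (meanCovMap S) := by
  have h1 : multivariateGaussian (0 : Vec d) S =
      (Measure.pi fun _ : Fin d => gaussianReal 0 1).map fun z =>
        Matrix.toEuclideanCLM (𝕜 := ℝ) (CFC.sqrt S) (WithLp.toLp 2 z) := by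
    rw [multivariateGaussian, ← map_pi_eq_stdGaussian, Measure.map_map (by fun_prop) (by fun_prop)]
    congr 1
    ext z
    simp
  have h2 : (wignerLaw d).map (conjSqrt S) =
      (Measure.pi fun p : UpperIdx d => gaussianReal 0 (if p.1.1 = p.1.2 then 2 else 1)).map
        fun z => conjSqrt S (symOfUpper z) := by
    rw [wignerLaw, Measure.map_map (continuous_conjSqrt S).measurable
      continuous_symOfUpper.measurable]
    rfl
  have hm1 : Measurable fun z : Fin d → ℝ =>
      Matrix.toEuclideanCLM (𝕜 := ℝ) (CFC.sqrt S) (WithLp.toLp 2 z) := by fun_prop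
  have hm2 : Measurable fun z : UpperIdx d → ℝ => conjSqrt S (symOfUpper z) :=
    ((continuous_conjSqrt S).comp continuous_symOfUpper).measurable
  have h3 := (measurePreserving_sumPiEquivProdPi
    fun k : MeanCovIdx d => gaussianReal 0 (coordVar k)).map_eq
  rw [meanCovLimit, h1, h2, Measure.map_prod_map _ _ hm1 hm2]
  refine (congrArg (Measure.map _) h3.symm).trans ?_
  rw [Measure.map_map (hm1.prodMap hm2) (MeasurableEquiv.measurable _)]
  rfl

theorem dual_comp_meanCovMap (S : Matrix (Fin d) (Fin d) ℝ) (L : StrongDual ℝ (Vec d × SymMat d))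
    (y : MeanCovIdx d → ℝ) :
    L (meanCovMap S y) = ∑ k, L (meanCovMap S (Pi.single k 1)) * y k := by
  have h := (L.toLinearMap ∘ₗ meanCovMap S).pi_apply_eq_sum_univ y
  simp only [LinearMap.comp_apply, ContinuousLinearMap.coe_coe, smul_eq_mul] at h
  rw [h]
  refine Finset.sum_congr rfl fun k _ => ?_
  rw [mul_comm]
  congr 3
  ext j
  simp [Pi.single_apply, eq_comm]

theorem hasLaw_dual_meanCovLimit (S : Matrix (Fin d) (Fin d) ℝ)
    (L : StrongDual ℝ (Vec d × SymMat d)) :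
    HasLaw L (gaussianReal 0
      (∑ k, L (meanCovMap S (Pi.single k 1)) ^ 2 * (coordVar k : ℝ)).toNNReal)
      (meanCovLimit S) := by
  refine ⟨L.continuous.measurable.aemeasurable, ?_⟩
  rw [meanCovLimit_eq_map, Measure.map_map L.continuous.measurable (measurable_meanCovMap S),
    ← map_sum_mul_pi_gaussianReal]
  congr 1
  ext y
  exact dual_comp_meanCovMap S L y

/-- The influence function of mean and covariance. -/
noncomputable def meanCovInfluence (μ : Vec d) (S : SymMat d) (x : Vec d) : Vec d × SymMat d :=
  (x - μ, outerSym (x - μ) - S)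

theorem measurable_meanCovInfluence (μ : Vec d) (S : SymMat d) :
    Measurable (meanCovInfluence μ S) := by
  have : Continuous (meanCovInfluence μ S) := by
    refine (continuous_id.sub continuous_const).prodMk ?_
    exact (continuous_outerSym.comp (continuous_id.sub continuous_const)).sub continuous_const
  exact this.measurable

theorem multivariateGaussian_eq_map_pi (μ : Vec d) (S : Matrix (Fin d) (Fin d) ℝ) :
    multivariateGaussian μ S = (Measure.pi fun _ : Fin d => gaussianReal 0 1).map fun z =>
      μ + Matrix.toEuclideanCLM (𝕜 := ℝ) (CFC.sqrt S) (WithLp.toLp 2 z) := by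
  rw [multivariateGaussian, ← map_pi_eq_stdGaussian, Measure.map_map (by fun_prop) (by fun_prop)]
  rfl

/-- With `x - μ = R z` and `R² = S` one has `(x - μ)(x - μ)ᵗ - S = R (z zᵗ - 1) R`, and the entries
of `z zᵗ - 1` are the Hermite products of degree two. The same linear map produces the limit law. -/
theorem meanCovInfluence_eq_meanCovMap (μ : Vec d) {S : SymMat d}
    (hS : (S : Matrix (Fin d) (Fin d) ℝ).PosSemidef) (z : Fin d → ℝ) :
    meanCovInfluence μ S
        (μ + Matrix.toEuclideanCLM (𝕜 := ℝ) (CFC.sqrt (S : Matrix (Fin d) (Fin d) ℝ))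
          (WithLp.toLp 2 z)) =
      meanCovMap S fun k => hermiteProd (multiIdx k) z := by
  set R := CFC.sqrt (S : Matrix (Fin d) (Fin d) ℝ) with hR
  have hRR : R * R = S := CFC.sqrt_mul_sqrt_self _ hS.nonneg
  have hRt : R.transpose = R := by
    have := (CFC.sqrt_nonneg (S : Matrix (Fin d) (Fin d) ℝ)).isSelfAdjoint.star_eq
    rwa [Matrix.star_eq_conjTranspose, Matrix.conjTranspose_eq_transpose_of_trivial] at this
  rw [meanCovMap_apply, meanCovInfluence, add_sub_cancel_left]
  refine Prod.ext ?_ (Subtype.ext ?_)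
  · simp only [hermiteProd_inl]
    rfl
  · have h1 : (symOfUpper fun p : UpperIdx d => hermiteProd (multiIdx (.inr p)) z :
        Matrix (Fin d) (Fin d) ℝ) = Matrix.vecMulVec z z - 1 := by
      ext i j
      show hermiteProd (multiIdx (.inr ⟨(min i j, max i j), _⟩)) z = _
      rw [hermiteProd_inr, Matrix.sub_apply, Matrix.vecMulVec_apply, Matrix.one_apply]
      rcases le_total i j with h | h
      · simp [h]
      · simp [h, mul_comm, eq_comm]
    show Matrix.vecMulVec _ _ - (S : Matrix (Fin d) (Fin d) ℝ) = R * _ * R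
    rw [h1, mul_sub, sub_mul, mul_one, hRR, Matrix.mul_vecMulVec, Matrix.vecMulVec_mul]
    congr 2
    rw [← Matrix.mulVec_transpose, hRt]
    rfl

theorem dual_meanCovInfluence (μ : Vec d) {S : SymMat d}
    (hS : (S : Matrix (Fin d) (Fin d) ℝ).PosSemidef) (L : StrongDual ℝ (Vec d × SymMat d)) :
    MemLp (fun x => L (meanCovInfluence μ S x)) 2 (multivariateGaussian μ S) ∧
    ∫ x, L (meanCovInfluence μ S x) ∂multivariateGaussian μ (S : Matrix (Fin d) (Fin d) ℝ) = 0 ∧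
    Var[fun x => L (meanCovInfluence μ S x); multivariateGaussian μ S] =
      ∑ k, L (meanCovMap S (Pi.single k 1)) ^ 2 * (coordVar k : ℝ) := by
  have hm : Measurable fun x => L (meanCovInfluence μ S x) :=
    L.continuous.measurable.comp (measurable_meanCovInfluence μ S)
  have hψ : Measurable fun z : Fin d → ℝ =>
      μ + Matrix.toEuclideanCLM (𝕜 := ℝ) (CFC.sqrt (S : Matrix (Fin d) (Fin d) ℝ))
        (WithLp.toLp 2 z) := by fun_prop
  have e : (fun x => L (meanCovInfluence μ S x)) ∘ (fun z : Fin d → ℝ =>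
      μ + Matrix.toEuclideanCLM (𝕜 := ℝ) (CFC.sqrt (S : Matrix (Fin d) (Fin d) ℝ))
        (WithLp.toLp 2 z)) =
      fun z => ∑ k, L (meanCovMap S (Pi.single k 1)) * hermiteProd (multiIdx k) z := by
    ext z
    rw [Function.comp_apply, meanCovInfluence_eq_meanCovMap μ hS, dual_comp_meanCovMap]
  rw [multivariateGaussian_eq_map_pi]
  refine ⟨?_, ?_, ?_⟩
  · rw [memLp_map_measure_iff hm.aestronglyMeasurable hψ.aemeasurable, e]
    exact memLp_sum_hermiteProd _
  · rw [integral_map hψ.aemeasurable hm.aestronglyMeasurable]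
    exact (integral_congr_ae (.of_forall fun z => congrFun e z)).trans (integral_sum_hermiteProd _)
  · rw [variance_map hm.aemeasurable hψ.aemeasurable, e, variance_sum_hermiteProd]

end Coordinates

/-! ### Central limit theorem for the influence function. -/

section CLT

variable {Ω : Type*} [MeasurableSpace Ω] {P : Measure Ω} [IsProbabilityMeasure P] {d : ℕ}

theorem tendstoInDistribution_sum_meanCovInfluence {μ : Vec d} {S : SymMat d}
    (hS : (S : Matrix (Fin d) (Fin d) ℝ).PosSemidef) {X : ℕ → Ω → Vec d}
    (hX : IsIIDSample X (multivariateGaussian μ S) P) :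
    TendstoInDistribution
      (fun (n : ℕ) ω => (√n)⁻¹ • ∑ i ∈ Finset.range n, meanCovInfluence μ S (X i ω)) atTop
      (fun w => w) (fun _ => P) (meanCovLimit (S : Matrix (Fin d) (Fin d) ℝ)) := by
  have hw := measurable_meanCovInfluence μ S
  have hXm : ∀ i, AEMeasurable (X i) P := fun i => (hX.2 i).aemeasurable
  have hLm : ∀ L : StrongDual ℝ (Vec d × SymMat d),
      Measurable fun x => L (meanCovInfluence μ S x) := fun L => L.continuous.measurable.comp hw
  refine tendstoInDistribution_inv_sqrt_smul_sum aemeasurable_id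
    (hX.1.comp (fun _ => meanCovInfluence μ S) fun _ => hw) (fun i => ?_) (fun L => ?_)
    (fun L => ?_) (fun L => ?_)
  · exact (IdentDistrib.mk (hXm i) (hXm 0) (by rw [(hX.2 i).map_eq, (hX.2 0).map_eq])).comp hw
  · have h := (dual_meanCovInfluence μ hS L).1
    rw [← (hX.2 0).map_eq, memLp_map_measure_iff (hLm L).aestronglyMeasurable (hXm 0)] at h
    exact h
  · have h := (dual_meanCovInfluence μ hS L).2.1
    rw [← (hX.2 0).map_eq, integral_map (hXm 0) (hLm L).aestronglyMeasurable] at h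
    exact h
  · have h := (dual_meanCovInfluence μ hS L).2.2
    rw [← (hX.2 0).map_eq, variance_map (hLm L).aemeasurable (hXm 0)] at h
    have e : Var[fun ω => L (meanCovInfluence μ S (X 0 ω)); P] =
      ∑ k, L (meanCovMap S (Pi.single k 1)) ^ 2 * (coordVar k : ℝ) := h
    rw [e]
    exact hasLaw_dual_meanCovLimit _ L

end CLT

/-! ### Algebra of the sample mean and covariance. -/

section SampleStatistics

variable {d : ℕ}

/-- The sample covariance as an element of the space of symmetric matrices. -/
noncomputable def sampleCovSym (n : ℕ) (x : ℕ → Vec d) : SymMat d :=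
  ((n : ℝ) - 1)⁻¹ • ∑ i ∈ Finset.range n, outerSym (x i - sampleMean n x)

theorem coe_sampleCovSym (n : ℕ) (x : ℕ → Vec d) :
    (sampleCovSym n x : Matrix (Fin d) (Fin d) ℝ) = sampleCov n x := by
  rw [sampleCovSym, sampleCov, Submodule.coe_smul, Submodule.coe_sum]
  rfl

theorem posSemidef_sampleCov (n : ℕ) (x : ℕ → Vec d) : (sampleCov n x).PosSemidef := by
  have hs : (∑ i ∈ Finset.range n, Matrix.vecMulVec (x i - sampleMean n x).ofLp
      (x i - sampleMean n x).ofLp).PosSemidef :=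
    Matrix.posSemidef_sum _ fun i _ => by
      simpa using Matrix.posSemidef_vecMulVec_self_star (x i - sampleMean n x).ofLp
  -- For `n = 0` the prefactor is `-1` but the sum is empty; for `n = 1` the prefactor is `0⁻¹ = 0`.
  rcases n with _ | n
  · simpa [sampleCov] using Matrix.PosSemidef.zero
  · exact hs.smul (by simp)

theorem continuous_sampleMean (n : ℕ) : Continuous (sampleMean (d := d) n) := by
  unfold sampleMean
  fun_prop

theorem continuous_sampleCovSym (n : ℕ) : Continuous (sampleCovSym (d := d) n) := by
  have h : ∀ i, Continuous fun x : ℕ → Vec d => outerSym (x i - sampleMean n x) := fun i =>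
    continuous_outerSym.comp ((continuous_apply i).sub (continuous_sampleMean n))
  exact (continuous_finsetSum (Finset.range n) fun i _ => h i).const_smul ((n : ℝ) - 1)⁻¹

theorem sqrt_smul_sampleMean_sub (n : ℕ) (x : ℕ → Vec d) (μ : Vec d) :
    √(n : ℝ) • (sampleMean n x - μ) = (√(n : ℝ))⁻¹ • ∑ i ∈ Finset.range n, (x i - μ) := by
  rcases Nat.eq_zero_or_pos n with rfl | hn
  · simp
  have hn' : (0 : ℝ) < n := by exact_mod_cast hn
  have h1 : √(n : ℝ) * (n : ℝ)⁻¹ = (√(n : ℝ))⁻¹ := by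
    rw [← div_eq_mul_inv, Real.sqrt_div_self]
  have h2 : (√(n : ℝ))⁻¹ * n = √(n : ℝ) := by
    rw [mul_comm, ← div_eq_mul_inv, Real.div_sqrt]
  rw [Finset.sum_sub_distrib, Finset.sum_const, Finset.card_range, sampleMean, smul_sub, smul_smul,
    smul_sub, h1, ← Nat.cast_smul_eq_nsmul ℝ, smul_smul, h2]

/-- Recentring costs `n (x̄ - μ)(x̄ - μ)ᵗ`, written as the outer square of the normalised sum
because that sum converges in law. -/
theorem sum_outerSym_sub_sampleMean (n : ℕ) (x : ℕ → Vec d) (μ : Vec d) :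
    ∑ i ∈ Finset.range n, outerSym (x i - sampleMean n x) =
      (∑ i ∈ Finset.range n, outerSym (x i - μ)) -
        outerSym ((√(n : ℝ))⁻¹ • ∑ i ∈ Finset.range n, (x i - μ)) := by
  rw [← sqrt_smul_sampleMean_sub]
  set m := sampleMean n x with hm
  have hsum : ∑ i ∈ Finset.range n, x i = (n : ℝ) • m := by
    rcases Nat.eq_zero_or_pos n with rfl | hn
    · simp
    · have hn' : (n : ℝ) ≠ 0 := by positivity
      rw [hm, sampleMean, smul_smul, mul_inv_cancel₀ hn', one_smul]
  have hc : ∀ i, ∑ k ∈ Finset.range n, (x k).ofLp i = n * m.ofLp i := fun i => by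
    have := congrArg (fun v : Vec d => v.ofLp i) hsum
    simpa using this
  refine Subtype.ext (Matrix.ext fun i j => ?_)
  rw [AddSubgroupClass.coe_sub, Submodule.coe_sum, Submodule.coe_sum, Matrix.sub_apply,
    Matrix.sum_apply, Matrix.sum_apply]
  simp only [coe_outerSym, Matrix.vecMulVec_apply, PiLp.sub_apply, PiLp.smul_apply, smul_eq_mul]
  have hs : √(n : ℝ) * √(n : ℝ) = n := Real.mul_self_sqrt (by positivity)
  have e1 : ∀ c : Vec d,
      ∑ k ∈ Finset.range n, ((x k).ofLp i - c.ofLp i) * ((x k).ofLp j - c.ofLp j) =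
      ∑ k ∈ Finset.range n, (x k).ofLp i * (x k).ofLp j - n * m.ofLp i * c.ofLp j
        - c.ofLp i * (n * m.ofLp j) + n * (c.ofLp i * c.ofLp j) := fun c => by
    simp only [sub_mul, mul_sub, Finset.sum_sub_distrib, ← Finset.sum_mul, ← Finset.mul_sum, hc,
      Finset.sum_const, Finset.card_range, nsmul_eq_mul]
    ring
  rw [e1 m, e1 μ]
  linear_combination (m.ofLp i - μ.ofLp i) * (m.ofLp j - μ.ofLp j) * hs

/-- Isolates the normalised influence sum; the three scalar factors tend to 1, 0 and 0. -/
theorem sqrt_smul_sampleCovSym_sub (n : ℕ) (x : ℕ → Vec d) (μ : Vec d) (S : SymMat d) :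
    √(n : ℝ) • (sampleCovSym n x - S) =
      ((n : ℝ) / (n - 1)) • ((√(n : ℝ))⁻¹ • ∑ i ∈ Finset.range n, (outerSym (x i - μ) - S)) +
        (√(n : ℝ) * (n / (n - 1) - 1)) • S -
        (√(n : ℝ) / (n - 1)) • outerSym ((√(n : ℝ))⁻¹ • ∑ i ∈ Finset.range n, (x i - μ)) := by
  have h0 : ∑ i ∈ Finset.range n, (outerSym (x i - μ) - S) =
      ∑ i ∈ Finset.range n, outerSym (x i - μ) - (n : ℝ) • S := by
    rw [Finset.sum_sub_distrib, Finset.sum_const, Finset.card_range, Nat.cast_smul_eq_nsmul ℝ]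
  rw [sampleCovSym, sum_outerSym_sub_sampleMean n x μ, h0]
  rcases Nat.eq_zero_or_pos n with rfl | hn
  · simp
  have hn' : √(n : ℝ) ≠ 0 := by positivity
  have hs : (n : ℝ) = √(n : ℝ) * √(n : ℝ) := (Real.mul_self_sqrt (by positivity)).symm
  have h1 : (n : ℝ) / (n - 1) * (√(n : ℝ))⁻¹ = √(n : ℝ) * ((n : ℝ) - 1)⁻¹ := by
    field_simp
    rw [sq, ← hs]
  rw [smul_smul, h1]
  module

theorem tendsto_sample_size_factors :
    Tendsto (fun n : ℕ => ((n : ℝ) / (n - 1), √(n : ℝ) * (n / (n - 1) - 1), √(n : ℝ) / (n - 1)))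
      atTop (𝓝 ((1 : ℝ), (0 : ℝ), (0 : ℝ))) := by
  have ha : Tendsto (fun n : ℕ => (n : ℝ) / (n - 1)) atTop (𝓝 1) := by
    simpa [sub_eq_add_neg] using tendsto_natCast_div_add_atTop (-1 : ℝ)
  have hi : Tendsto (fun n : ℕ => (√(n : ℝ))⁻¹) atTop (𝓝 0) :=
    (Real.tendsto_sqrt_atTop.comp tendsto_natCast_atTop_atTop).inv_tendsto_atTop
  have hc : Tendsto (fun n : ℕ => √(n : ℝ) / (n - 1)) atTop (𝓝 0) := by
    have h := ha.mul hi
    rw [mul_zero] at h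
    refine h.congr fun n => ?_
    rw [div_mul_eq_mul_div, ← div_eq_mul_inv, Real.div_sqrt]
  refine ha.prodMk_nhds (Tendsto.prodMk_nhds (hc.congr' ?_) hc)
  -- Once `n - 1 ≠ 0`, the second factor equals the third.
  filter_upwards [eventually_ge_atTop 2] with n hn
  have : (n : ℝ) - 1 ≠ 0 := by
    have : (2 : ℝ) ≤ n := by exact_mod_cast hn
    linarith
  field_simp
  ring

theorem aemeasurable_of_isIIDSample {Ω : Type*} [MeasurableSpace Ω] {P : Measure Ω}
    {X : ℕ → Ω → Vec d} {Q : Measure (Vec d)} (hX : IsIIDSample X Q P) :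
    AEMeasurable (fun ω i => X i ω) P :=
  aemeasurable_pi_iff.2 fun i => (hX.2 i).aemeasurable

end SampleStatistics

/-! ### Limit theorems for the estimators. -/

section Limit

variable {Ω : Type*} [MeasurableSpace Ω] {P : Measure Ω} [IsProbabilityMeasure P] {d : ℕ}

theorem tendstoInDistribution_sampleMean_sampleCov {μ : Vec d} {S : SymMat d}
    (hS : (S : Matrix (Fin d) (Fin d) ℝ).PosSemidef) {X : ℕ → Ω → Vec d}
    (hX : IsIIDSample X (multivariateGaussian μ S) P) :
    TendstoInDistribution
      (fun (n : ℕ) ω => (√(n : ℝ) • (sampleMean n (fun i => X i ω) - μ),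
        √(n : ℝ) • (sampleCovSym n (fun i => X i ω) - S))) atTop
      (fun w => w) (fun _ => P) (meanCovLimit (S : Matrix (Fin d) (Fin d) ℝ)) := by
  have hg : Continuous fun p : (Vec d × SymMat d) × (ℝ × ℝ × ℝ) =>
      (p.1.1, p.2.1 • p.1.2 + p.2.2.1 • S - p.2.2.2 • outerSym p.1.1) := by
    have := continuous_outerSym (d := d)
    fun_prop
  have h := (tendstoInDistribution_sum_meanCovInfluence hS hX)
    |>.continuous_comp_prodMk_of_tendstoInMeasure_const hg
    (Y := fun (n : ℕ) _ => ((n : ℝ) / (n - 1), √(n : ℝ) * (n / (n - 1) - 1), √(n : ℝ) / (n - 1)))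
    (c := ((1 : ℝ), (0 : ℝ), (0 : ℝ)))
    (tendstoInMeasure_of_tendsto_ae (fun n => aestronglyMeasurable_const)
      (.of_forall fun _ => tendsto_sample_size_factors)) (fun n => aemeasurable_const)
  refine h.congr (fun n => .of_forall fun ω => ?_) (.of_forall fun w => by simp)
  beta_reduce
  rw [sqrt_smul_sampleMean_sub, sqrt_smul_sampleCovSym_sub n _ μ]
  simp [meanCovInfluence, Prod.fst_sum, Prod.snd_sum]

theorem gwOne_eq_Φ (n : ℕ) (x : ℕ → Vec d) (μ : Vec d) {S : SymMat d}
    (hS : (S : Matrix (Fin d) (Fin d) ℝ).PosSemidef) :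
    gwOne n x (multivariateGaussian μ S) = Φ d (sampleMean n x, μ, sampleCovSym n x, S) := by
  rw [gwOne, fittedGaussian, ← coe_sampleCovSym]
  refine wassersteinTwoSq_multivariateGaussian _ _ ?_ hS
  rw [coe_sampleCovSym]
  exact posSemidef_sampleCov n x

theorem gwTwo_eq_Φ (n m : ℕ) (x y : ℕ → Vec d) :
    gwTwo n m x y = Φ d (sampleMean n x, sampleMean m y, sampleCovSym n x, sampleCovSym m y) := by
  rw [gwTwo, fittedGaussian, fittedGaussian, ← coe_sampleCovSym, ← coe_sampleCovSym]
  refine wassersteinTwoSq_multivariateGaussian _ _ ?_ ?_ <;>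
  · rw [coe_sampleCovSym]
    exact posSemidef_sampleCov _ _

theorem tendstoInDistribution_gwOne {μ : Vec d} {S : SymMat d}
    (hS : (S : Matrix (Fin d) (Fin d) ℝ).PosDef) {X : ℕ → Ω → Vec d}
    (hX : IsIIDSample X (multivariateGaussian μ S) P) :
    TendstoInDistribution
      (fun (n : ℕ) ω => (n : ℝ) * gwOne n (fun i => X i ω) (multivariateGaussian μ S))
      atTop (limitOne μ S) (fun _ => P) (meanCovLimit (S : Matrix (Fin d) (Fin d) ℝ)) := by
  simp only [gwOne_eq_Φ _ _ _ hS.posSemidef]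
  refine tendstoInDistribution_second_order_delta (θ := (μ, μ, S, S))
    (T := fun n ω => (sampleMean n (fun i => X i ω), μ, sampleCovSym n (fun i => X i ω), S))
    -- The known parameters of the reference law do not fluctuate, hence the zeros.
    (Z := fun w : Vec d × SymMat d => (w.1, (0 : Vec d), w.2, (0 : SymMat d)))
    measurable_Φ (contDiffAt_Φ hS hS (by norm_num)) (by simp [Φ_self _ _ hS.posSemidef])
    (fderiv_Φ_self _ hS) (fun n => ?_) ?_
  · exact (((continuous_sampleMean n).prodMk (continuous_const.prodMk
      ((continuous_sampleCovSym n).prodMk continuous_const))).measurable).comp_aemeasurable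
      (aemeasurable_of_isIIDSample hX)
  · have hg : Continuous fun w : Vec d × SymMat d => (w.1, (0 : Vec d), w.2, (0 : SymMat d)) := by
      fun_prop
    refine ((tendstoInDistribution_sampleMean_sampleCov hS.posSemidef hX).continuous_comp
      hg).congr (fun n => .of_forall fun ω => ?_) (.of_forall fun w => rfl)
    simp

theorem tendstoInDistribution_gwTwo {μ : Vec d} {S : SymMat d}
    (hS : (S : Matrix (Fin d) (Fin d) ℝ).PosDef) {X Y : ℕ → Ω → Vec d}
    (hX : IsIIDSample X (multivariateGaussian μ S) P)
    (hY : IsIIDSample Y (multivariateGaussian μ S) P)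
    (hXY : IndepFun (fun ω i => X i ω) (fun ω i => Y i ω) P) :
    TendstoInDistribution
      (fun (n : ℕ) ω => (n : ℝ) * gwTwo n n (fun i => X i ω) (fun i => Y i ω))
      atTop (limitTwo μ S) (fun _ => P)
      ((meanCovLimit (S : Matrix (Fin d) (Fin d) ℝ)).prod (meanCovLimit S)) := by
  simp only [gwTwo_eq_Φ]
  refine tendstoInDistribution_second_order_delta (θ := (μ, μ, S, S))
    (T := fun n ω => (sampleMean n (fun i => X i ω), sampleMean n (fun i => Y i ω),
      sampleCovSym n (fun i => X i ω), sampleCovSym n (fun i => Y i ω)))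
    (Z := fun w : (Vec d × SymMat d) × (Vec d × SymMat d) => (w.1.1, w.2.1, w.1.2, w.2.2))
    measurable_Φ (contDiffAt_Φ hS hS (by norm_num)) (by simp [Φ_self _ _ hS.posSemidef])
    (fderiv_Φ_self _ hS) (fun n => ?_) ?_
  · have h1 := (continuous_sampleMean (d := d) n).measurable
    have h2 := (continuous_sampleCovSym (d := d) n).measurable
    exact (h1.comp_aemeasurable (aemeasurable_of_isIIDSample hX)).prodMk
      ((h1.comp_aemeasurable (aemeasurable_of_isIIDSample hY)).prodMk
      ((h2.comp_aemeasurable (aemeasurable_of_isIIDSample hX)).prodMk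
        (h2.comp_aemeasurable (aemeasurable_of_isIIDSample hY))))
  · have hg : Continuous fun w : (Vec d × SymMat d) × (Vec d × SymMat d) =>
        (w.1.1, w.2.1, w.1.2, w.2.2) := by
      fun_prop
    have hm : ∀ n : ℕ, Measurable fun x : ℕ → Vec d =>
        (√(n : ℝ) • (sampleMean n x - μ), √(n : ℝ) • (sampleCovSym n x - S)) := fun n => by
      have h1 := continuous_sampleMean (d := d) n
      have h2 := continuous_sampleCovSym (d := d) n
      have : Continuous fun x : ℕ → Vec d =>
        (√(n : ℝ) • (sampleMean n x - μ), √(n : ℝ) • (sampleCovSym n x - S)) := by fun_prop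
      exact this.measurable
    have h := TendstoInDistribution.prodMk_of_indepFun
      (tendstoInDistribution_sampleMean_sampleCov hS.posSemidef hX)
      (tendstoInDistribution_sampleMean_sampleCov hS.posSemidef hY)
      (fun n => hXY.comp (hm n) (hm n))
    refine (h.continuous_comp hg).congr (fun n => .of_forall fun ω => ?_) (.of_forall fun w => rfl)
    simp

end Limit

/-! ### Nondegeneracy of the limits. -/

section Nondegenerate

variable {d : ℕ}

/-- Along `t ↦ (μ + t g, μ, S, S)` the functional is exactly `t² ‖g‖²`. A different quadratic
coefficient in the Taylor expansion would make `t²` negligible against itself. -/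
theorem half_secondDerivΦ_fst (μ g : Vec d) {S : SymMat d}
    (hS : (S : Matrix (Fin d) (Fin d) ℝ).PosDef) :
    (1 / 2) * secondDerivΦ d (μ, μ, S, S) (g, 0, 0, 0) = ‖g‖ ^ 2 := by
  set h : Vec d × Vec d × SymMat d × SymMat d := (g, 0, 0, 0) with hh
  set θ : Vec d × Vec d × SymMat d × SymMat d := (μ, μ, S, S) with hθ
  by_contra hne
  set c : ℝ := ‖g‖ ^ 2 - (1 / 2) * secondDerivΦ d θ h with hc
  have hc0 : c ≠ 0 := fun h0 => hne (by linarith)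
  have ht : Tendsto (fun t : ℝ => t • h) (𝓝 0) (𝓝 0) := by
    have : Continuous fun t : ℝ => t • h := by fun_prop
    simpa using this.tendsto 0
  have h1 := ((contDiffAt_Φ hS hS (by norm_num)).isLittleO_second_order
    (fderiv_Φ_self μ hS)).comp_tendsto ht
  have h2 : (fun t : ℝ => c * t ^ 2) =o[𝓝 0] fun t : ℝ => t ^ 2 := by
    refine (h1.congr_left fun t => ?_).trans_isBigO ?_
    · have e : θ + t • h = (μ + t • g, μ, S, S) := by simp [hθ, hh]
      simp only [Function.comp_apply]
      rw [← hθ, e, hθ, Φ_self _ _ hS.posSemidef, Φ_self _ _ hS.posSemidef, ← hθ, hc, secondDerivΦ,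
        map_smul, map_smul, _root_.smul_apply, smul_eq_mul, smul_eq_mul]
      simp only [add_sub_cancel_left, norm_smul, sub_self, norm_zero, mul_pow, Real.norm_eq_abs,
        sq_abs]
      ring
    · refine Asymptotics.IsBigO.of_bound (‖h‖ ^ 2) (.of_forall fun t => ?_)
      simp only [Function.comp_apply, norm_smul, norm_pow, norm_norm, mul_pow, norm_mul]
      rw [mul_comm]
  rw [Asymptotics.isLittleO_const_mul_left_iff hc0] at h2
  refine Asymptotics.isLittleO_irrefl (l := 𝓝 (0 : ℝ)) ?_ h2
  have : ∃ᶠ t : ℝ in 𝓝[{0}ᶜ] 0, t ^ 2 ≠ 0 :=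
    Eventually.frequently <| by
      filter_upwards [self_mem_nhdsWithin] with t ht using pow_ne_zero 2 ht
  exact this.filter_mono nhdsWithin_le_nhds

theorem surjective_meanCovMap {S : Matrix (Fin d) (Fin d) ℝ} (hS : S.PosDef) :
    Function.Surjective (meanCovMap S) := by
  set R := CFC.sqrt S with hR
  have hu : IsUnit R := (posDef_sqrt hS).isUnit
  have hdet : IsUnit R.det := (Matrix.isUnit_iff_isUnit_det _).1 hu
  have hRi : R⁻¹.IsHermitian := (posDef_sqrt hS).isHermitian.inv
  rintro ⟨v, H⟩
  have hK : IsSelfAdjoint (R⁻¹ * (H : Matrix (Fin d) (Fin d) ℝ) * R⁻¹) := by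
    have hH : IsSelfAdjoint (H : Matrix (Fin d) (Fin d) ℝ) := H.2
    have hRs : star R⁻¹ = R⁻¹ := hRi
    rw [IsSelfAdjoint, star_mul, star_mul, hH.star_eq, hRs, mul_assoc]
  refine ⟨Sum.elim (Matrix.toEuclideanCLM (𝕜 := ℝ) R⁻¹ v).ofLp
    fun p => (R⁻¹ * (H : Matrix (Fin d) (Fin d) ℝ) * R⁻¹) p.1.1 p.1.2, ?_⟩
  rw [meanCovMap_apply]
  refine Prod.ext ?_ (Subtype.ext ?_)
  · show Matrix.toEuclideanCLM (𝕜 := ℝ) R (Matrix.toEuclideanCLM (𝕜 := ℝ) R⁻¹ v) = v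
    rw [← mul_apply_eq_comp, ← map_mul, Matrix.mul_nonsing_inv _ hdet, map_one]
    rfl
  · have e : (symOfUpper fun p => (R⁻¹ * (H : Matrix (Fin d) (Fin d) ℝ) * R⁻¹) p.1.1 p.1.2 :
        Matrix (Fin d) (Fin d) ℝ) = R⁻¹ * (H : Matrix (Fin d) (Fin d) ℝ) * R⁻¹ := by
      ext i j
      show (R⁻¹ * (H : Matrix (Fin d) (Fin d) ℝ) * R⁻¹) (min i j) (max i j) = _
      rcases le_total i j with h | h
      · simp [h]
      · rw [min_eq_right h, max_eq_left h]
        have := congrFun (congrFun hK.star_eq i) j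
        simpa [Matrix.star_apply] using this
    refine (congrArg (fun K => R * K * R) e).trans ?_
    rw [mul_assoc, mul_assoc, Matrix.nonsing_inv_mul _ hdet, mul_one, ← mul_assoc,
      Matrix.mul_nonsing_inv _ hdet, one_mul]

theorem isOpenPosMeasure_gaussianReal (m : ℝ) {v : NNReal} (hv : v ≠ 0) :
    (gaussianReal m v).IsOpenPosMeasure :=
  (gaussianReal_absolutelyContinuous' m hv).isOpenPosMeasure

/-- All coordinate variances are positive, and a continuous surjection carries full support to full
support. -/
theorem isOpenPosMeasure_meanCovLimit {S : Matrix (Fin d) (Fin d) ℝ} (hS : S.PosDef) :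
    (meanCovLimit S).IsOpenPosMeasure := by
  have hv : ∀ k : MeanCovIdx d, coordVar k ≠ 0 := by
    rintro (i | p)
    · simp [coordVar]
    · simp only [coordVar]; split_ifs <;> simp
  have := fun k : MeanCovIdx d => isOpenPosMeasure_gaussianReal 0 (hv k)
  rw [meanCovLimit_eq_map]
  exact (meanCovMap S).continuous_of_finiteDimensional.isOpenPosMeasure_map
    (surjective_meanCovMap hS)

/-- Under a measure of full support, a continuous function that is almost everywhere constant is
constant. -/
theorem map_ne_dirac_of_continuous {E : Type*} [TopologicalSpace E] [MeasurableSpace E]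
    [BorelSpace E] {ν : Measure E} [ν.IsOpenPosMeasure] {f : E → ℝ} (hf : Continuous f) {x y : E}
    (hxy : f x ≠ f y) (c : ℝ) : ν.map f ≠ Measure.dirac c := by
  intro h
  have h1 : ∀ᵐ z ∂ν, f z = c := by
    have : ∀ᵐ r ∂ν.map f, r = c := by rw [h, ae_dirac_eq]; rfl
    exact ae_of_ae_map hf.measurable.aemeasurable this
  have h2 : f = fun _ => c := (Continuous.ae_eq_iff_eq ν hf continuous_const).1 h1
  exact hxy (by rw [h2])

theorem continuous_secondDerivΦ (θ : Vec d × Vec d × SymMat d × SymMat d) :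
    Continuous (secondDerivΦ d θ) :=
  (fderiv ℝ (fderiv ℝ (Φ d)) θ).continuous.clm_apply continuous_id

theorem map_limitOne_ne_dirac (hd : 0 < d) (μ : Vec d) {S : SymMat d}
    (hS : (S : Matrix (Fin d) (Fin d) ℝ).PosDef) (c : ℝ) :
    (meanCovLimit (S : Matrix (Fin d) (Fin d) ℝ)).map (limitOne μ S) ≠ Measure.dirac c := by
  have := isOpenPosMeasure_meanCovLimit hS
  have hf : Continuous (limitOne μ S) := by
    have := continuous_secondDerivΦ (μ, μ, S, S)
    unfold limitOne
    fun_prop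
  have h0 := half_secondDerivΦ_fst μ 0 hS
  have h1 := half_secondDerivΦ_fst μ (EuclideanSpace.single ⟨0, hd⟩ 1) hS
  -- A unit mean shift gives the value 1 and the origin gives 0; the unit vector requires `d > 0`.
  refine map_ne_dirac_of_continuous hf (x := (EuclideanSpace.single ⟨0, hd⟩ 1, 0)) (y := (0, 0)) ?_ c
  rw [limitOne, limitOne, h0, h1]
  simp

theorem map_limitTwo_ne_dirac (hd : 0 < d) (μ : Vec d) {S : SymMat d}
    (hS : (S : Matrix (Fin d) (Fin d) ℝ).PosDef) (c : ℝ) :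
    ((meanCovLimit (S : Matrix (Fin d) (Fin d) ℝ)).prod (meanCovLimit S)).map (limitTwo μ S) ≠
      Measure.dirac c := by
  have := isOpenPosMeasure_meanCovLimit hS
  have hf : Continuous (limitTwo μ S) := by
    have := continuous_secondDerivΦ (μ, μ, S, S)
    unfold limitTwo
    fun_prop
  have h0 := half_secondDerivΦ_fst μ 0 hS
  have h1 := half_secondDerivΦ_fst μ (EuclideanSpace.single ⟨0, hd⟩ 1) hS
  refine map_ne_dirac_of_continuous hf (x := ((EuclideanSpace.single ⟨0, hd⟩ 1, 0), (0, 0)))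
    (y := ((0, 0), (0, 0))) ?_ c
  rw [limitTwo, limitTwo, h0, h1]
  simp

theorem eventually_differentiableAt_Φ (μ ν : Vec d) {A B : SymMat d}
    (hA : (A : Matrix (Fin d) (Fin d) ℝ).PosDef) (hB : (B : Matrix (Fin d) (Fin d) ℝ).PosDef) :
    ∀ᶠ θ in 𝓝 (μ, ν, A, B), DifferentiableAt ℝ (Φ d) θ := by
  have h : ContDiffAt ℝ 1 (Φ d) (μ, ν, A, B) := contDiffAt_Φ hA hB (by simp)
  filter_upwards [h.eventually (by simp)] with θ hθ using hθ.differentiableAt (by simp)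

theorem differentiableAt_fderiv_Φ (μ ν : Vec d) {A B : SymMat d}
    (hA : (A : Matrix (Fin d) (Fin d) ℝ).PosDef) (hB : (B : Matrix (Fin d) (Fin d) ℝ).PosDef) :
    DifferentiableAt ℝ (fderiv ℝ (Φ d)) (μ, ν, A, B) := by
  have h : ContDiffAt ℝ 2 (Φ d) (μ, ν, A, B) := contDiffAt_Φ hA hB (by simp)
  exact (h.fderiv_right (m := 1) (by norm_num)).differentiableAt (by simp)

end Nondegenerate

theorem theoremT {Ω : Type*} [MeasurableSpace Ω] (P : Measure Ω) [IsProbabilityMeasure P]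
    (d : ℕ) (hd : 0 < d) (μ : Vec d) (S : Matrix (Fin d) (Fin d) ℝ) (hS : S.PosDef)
    (X : ℕ → Ω → Vec d) (hX : IsIIDSample X (multivariateGaussian μ S) P) :
    -- the first derivative exists near `(μ, μ, S, S)` and vanishes there,
    -- and the second derivative exists
    ((∀ᶠ θ in 𝓝 (μ, μ, toSym S hS, toSym S hS), DifferentiableAt ℝ (Φ d) θ) ∧
      fderiv ℝ (Φ d) (μ, μ, toSym S hS, toSym S hS) = 0 ∧
      DifferentiableAt ℝ (fderiv ℝ (Φ d)) (μ, μ, toSym S hS, toSym S hS)) ∧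
    -- one sample
    TendstoInDistribution
      (fun (n : ℕ) ω => (n : ℝ) * gwOne n (fun i => X i ω) (multivariateGaussian μ S))
      atTop (limitOne μ (toSym S hS)) (fun _ => P) (meanCovLimit S) ∧
    (∀ c : ℝ, (meanCovLimit S).map (limitOne μ (toSym S hS)) ≠ Measure.dirac c) ∧
    -- two independent samples
    (∀ Y : ℕ → Ω → Vec d, IsIIDSample Y (multivariateGaussian μ S) P →
      IndepFun (fun ω i => X i ω) (fun ω i => Y i ω) P →
      TendstoInDistribution
        (fun (n : ℕ) ω => (n : ℝ) * gwTwo n n (fun i => X i ω) (fun i => Y i ω))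
        atTop (limitTwo μ (toSym S hS)) (fun _ => P) ((meanCovLimit S).prod (meanCovLimit S))) ∧
    (∀ c : ℝ, ((meanCovLimit S).prod (meanCovLimit S)).map (limitTwo μ (toSym S hS)) ≠
      Measure.dirac c) := by
  have hS' : (toSym S hS : Matrix (Fin d) (Fin d) ℝ).PosDef := hS
  exact ⟨⟨eventually_differentiableAt_Φ μ μ hS' hS', fderiv_Φ_self μ hS',
    differentiableAt_fderiv_Φ μ μ hS' hS'⟩, tendstoInDistribution_gwOne hS' hX,
    map_limitOne_ne_dirac hd μ hS', fun Y hY hXY => tendstoInDistribution_gwTwo hS' hX hY hXY,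
    map_limitTwo_ne_dirac hd μ hS'⟩
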